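/- **Setting.** Let $I=(0,1)$, $n\in\mathbb N$, $\varepsilon\ge 0$, $\gamma\ge 0$ and $\bar\vartheta=(\bar\vartheta_1,\dots,\bar\vartheta_n)\in L^2(I)^n$. Let $H^1_{0L}(I)=\{v\in H^1(I): v(0)=0\}$ be equipped with the norm $\|v\|^2=\int_0^1 (v')^2$, let $\vec m(v)=(\cos v,\sin v)$, so that $D\vec m(v)=(-\sin v,\cos v)$ and $D^2\vec m(v)=(-\cos v,-\sin v)$, and put $\mathcal H=\mathbb R^{2n}\times H^1_{0L}(I)\times H^1_{0L}(I)^n$. For $c\ge 0$ and a function $f$ on $I$, a weak solution of $-cv''+f=0$ in $I$, $cv(0)=cv'(1)=0$, is a $v\in H^1_{0L}(I)$ with $c\int_0^1 v'w'+\int_0^1 fw=0$ for all $w\in H^1_{0L}(I)$. The admissible set $\mathcal A$ consists of the $(\vec h,\alpha,\vartheta)\in\mathcal H$, $\vec h=(\vec h_1,\dots,\vec h_n)$, $\vartheta=(\vartheta_1,\dots,\vartheta_n)$, such that for each $i=1,\dots,n$ the function $\vartheta_i$ is a weak solution of $-\vartheta_i''-\vec h_i\cdot D\vec m(\alpha+\vartheta_i)=0$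 in $I$, $\vartheta_i(0)=\vartheta_i'(1)=0$. The cost is $$\mathcal C(\vec h,\alpha,\vartheta)=\frac12\sum_{i=1}^n\int_0^1|\vartheta_i-\bar\vartheta_i|^2+\frac\varepsilon2\int_0^1|\alpha'|^2+\frac\gamma2\sum_{i=1}^n|\vec h_i|^2 ,$$ and the constraint map $G:\mathcal H\to (H^1_{0L}(I)^n)'$ is $$\langle G(\vec h,\alpha,\vartheta),u\rangle=\sum_{i=1}^n\Big\{\int_0^1\vartheta_i'u_i'-\int_0^1\vec h_i\cdot D\vec m(\alpha+\vartheta_i)\,u_i\Big\},\qquad u\in H^1_{0L}(I)^n .$$ A point of $\mathcal A$ is called regular if $G$ is Fréchet differentiable there and its differential $DG$ at that point is surjective. Write $r^\pm=\max\{\pm r,0\}$. **Theorem 1.2.** The map $G$ is of class $C^1$ on $\mathcal H$. Let $(\vec h,\alpha,\vartheta)$ be a minimizer of $\mathcal C$ in $\mathcal A$. (i) For each $i$ let $r_i=\vec h_i\cdot D^2\vec m(\alpha+\vartheta_i)$. If for every $i=1,\dots,n$ the number $\mu=1$ is not an eigenvalue of $$-u''+(r_i^-+1)u=\mu\,(r_i^++1)u\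 \text{ in } I,\qquad u(0)=0,\ u'(1)=0$$ (that is, for $\mu=1$ this problem has no nonzero weak solution $u\in H^1_{0L}(I)$), then $(\vec h,\alpha,\vartheta)$ is a regular point. (ii) In particular, $(\vec h,\alpha,\vartheta)$ is a regular point if $|\vec h_i|<c_p^{-2}$ for all $i=1,\dots,n$, where $c_p=2/\pi$, so that $c_p^{-2}=\pi^2/4$. (iii) If $(\vec h,\alpha,\vartheta)$ is a regular point, then there is a Lagrange multiplier $\lambda=(\lambda_1,\dots,\lambda_n)\in H^1_{0L}(I)^n$, i.e. $D\mathcal C(\vec h,\alpha,\vartheta)\psi=\langle DG(\vec h,\alpha,\vartheta)\psi,\lambda\rangle$ for all $\psi\in\mathcal H$, such that for every $i=1,\dots,n$ $$\begin{cases} -\vartheta_i''-\vec h_i\cdot D\vec m(\alpha+\vartheta_i)=0, & \vartheta_i(0)=\vartheta_i'(1)=0,\\ -\lambda_i''-\lambda_i\,\vec h_i\cdot D^2\vec m(\alpha+\vartheta_i)=\vartheta_i-\bar\vartheta_i, & \lambda_i(0)=\lambda_i'(1)=0,\\ -\varepsilon\alpha''+\sum_{j=1}^n\lambda_j\,\vec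 h_j\cdot D^2\vec m(\alpha+\vartheta_j)=0, & \varepsilon\alpha(0)=\varepsilon\alpha'(1)=0,\\ \gamma\vec h_i=-\int_0^1\lambda_i\,D\vec m(\alpha+\vartheta_i), \end{cases}\tag{EQ}$$ where the differential equations hold both in the weak sense and almost everywhere in $I$, and the boundary conditions hold pointwise. Furthermore, if $\varepsilon>0$, then $\alpha'(0)=0$. -/

import Mathlib

open MeasureTheory Set
open scoped ContDiff

namespace MagElastica

noncomputable section

/-- `L²(I)`, where `I = (0,1)`. -/
abbrev L2I : Type := Lp ℝ 2 (volume.restrict (Ioo (0 : ℝ) 1))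

/-- `g` is a weak derivative of `v` in `I = (0,1)`: `∫ v φ' = - ∫ g φ` for all `φ ∈ C_c^∞(I)`. -/
def HasWeakDeriv (v g : ℝ → ℝ) : Prop :=
  ∀ φ : ℝ → ℝ, ContDiff ℝ ∞ φ → HasCompactSupport φ → tsupport φ ⊆ Ioo (0 : ℝ) 1 →
    ∫ s in Ioo (0 : ℝ) 1, v s * deriv φ s = -∫ s in Ioo (0 : ℝ) 1, g s * φ s

theorem setIntegral_mul_of_tsupport {f φ : ℝ → ℝ} (hφ : tsupport φ ⊆ Ioo (0 : ℝ) 1) :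
    ∫ s in Ioo (0 : ℝ) 1, f s * φ s = ∫ s, f s * φ s := by
  apply setIntegral_eq_integral_of_forall_compl_eq_zero
  intro x hx
  have : φ x = 0 := image_eq_zero_of_notMem_tsupport (fun h => hx (hφ h))
  simp [this]

theorem integrableOn_mul_test {v φ : ℝ → ℝ} (hv : IntegrableOn v (Ioo (0 : ℝ) 1))
    (hφ : Continuous φ) : IntegrableOn (fun s => v s * φ s) (Ioo (0 : ℝ) 1) := by
  obtain ⟨C, hC⟩ := isCompact_Icc.exists_bound_of_continuousOn (s := Icc (0 : ℝ) 1) hφ.continuousOn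
  refine Integrable.mul_bdd (c := C) hv hφ.aestronglyMeasurable ?_
  filter_upwards [ae_restrict_mem measurableSet_Ioo] with x hx
  exact hC x (Ioo_subset_Icc_self hx)

/-- A smooth function with support in `I` and zero mean is the derivative of a test function. -/
theorem exists_test_primitive {χ : ℝ → ℝ} (h1 : ContDiff ℝ ∞ χ) (h2 : HasCompactSupport χ)
    (h3 : tsupport χ ⊆ Ioo (0 : ℝ) 1) (h4 : ∫ s, χ s = 0) :
    ∃ Φ : ℝ → ℝ, ContDiff ℝ ∞ Φ ∧ HasCompactSupport Φ ∧ tsupport Φ ⊆ Ioo (0 : ℝ) 1 ∧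
      deriv Φ = χ := by
  obtain ⟨a, b, ha, hb, hab⟩ : ∃ a b : ℝ, 0 < a ∧ b < 1 ∧ tsupport χ ⊆ Icc a b := by
    rcases (tsupport χ).eq_empty_or_nonempty with he | hne
    · exact ⟨1 / 2, 1 / 2, by norm_num, by norm_num, by simp [he]⟩
    · obtain ⟨a, haS, ha⟩ := h2.isCompact.exists_isLeast hne
      obtain ⟨b, hbS, hb⟩ := h2.isCompact.exists_isGreatest hne
      exact ⟨a, b, (h3 haS).1, (h3 hbS).2, fun x hx => ⟨ha hx, hb hx⟩⟩
  have hz : ∀ x, x ∉ Icc a b → χ x = 0 := fun x hx =>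
    image_eq_zero_of_notMem_tsupport (fun h => hx (hab h))
  set Φ : ℝ → ℝ := fun x => ∫ t in (0 : ℝ)..x, χ t with hΦ
  have hd : ∀ x, HasDerivAt Φ (χ x) x := fun x =>
    intervalIntegral.integral_hasDerivAt_right (h1.continuous.intervalIntegrable _ _)
      h1.continuous.aestronglyMeasurable.stronglyMeasurableAtFilter h1.continuous.continuousAt
  have hderiv : deriv Φ = χ := funext fun x => (hd x).deriv
  have hsupp : Function.support Φ ⊆ Icc a b := by
    intro x hx
    by_contra hxn
    apply hx
    rcases lt_or_ge x a with hxa | hxa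
    · have : ∀ t ∈ uIcc 0 x, χ t = 0 := by
        intro t ht
        apply hz
        intro h
        rcases (mem_uIcc.1 ht) with h' | h'
        · linarith [h.1, h'.2]
        · linarith [h.1, h'.2]
      simp only [hΦ]
      rw [intervalIntegral.integral_congr (g := fun _ => 0) this]
      simp
    · have hxb : b < x := by
        by_contra hh
        exact hxn ⟨hxa, not_lt.1 hh⟩
      simp only [hΦ]
      rw [intervalIntegral.integral_of_le (by linarith), ← h4]
      apply setIntegral_eq_integral_of_forall_compl_eq_zero
      intro t ht
      apply hz
      intro h
      exact ht ⟨by linarith [h.1], by linarith [h.2]⟩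
  have hts : tsupport Φ ⊆ Icc a b := closure_minimal hsupp isClosed_Icc
  refine ⟨Φ, ?_, ?_, ?_, hderiv⟩
  · rw [contDiff_infty_iff_deriv, hderiv]
    exact ⟨fun x => (hd x).differentiableAt, h1⟩
  · exact IsCompact.of_isClosed_subset isCompact_Icc (isClosed_tsupport _) hts
  · exact hts.trans fun x hx => ⟨by linarith [hx.1], by linarith [hx.2]⟩

/-- du Bois-Reymond: a continuous function with vanishing weak derivative is constant. -/
theorem HasWeakDeriv.exists_const {v : ℝ → ℝ} (hv : ContinuousOn v (Icc (0 : ℝ) 1))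
    (h : HasWeakDeriv v (fun _ => 0)) : ∃ c, ∀ s ∈ Icc (0 : ℝ) 1, v s = c := by
  have hvi : IntegrableOn v (Ioo (0 : ℝ) 1) :=
    (hv.integrableOn_Icc).mono_set Ioo_subset_Icc_self
  let B : ContDiffBump (1 / 2 : ℝ) := ⟨1 / 8, 1 / 4, by norm_num, by norm_num⟩
  set ψ : ℝ → ℝ := B.normed volume with hψ
  have hψ1 : ContDiff ℝ ∞ ψ := B.contDiff_normed
  have hψ2 : HasCompactSupport ψ := B.hasCompactSupport_normed
  have hψ3 : tsupport ψ ⊆ Ioo (0 : ℝ) 1 := by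
    rw [hψ, B.tsupport_normed_eq, Real.closedBall_eq_Icc]
    intro x hx
    simp only [B] at hx
    constructor <;> [linarith [hx.1]; linarith [hx.2]]
  have hψ4 : ∫ s, ψ s = 1 := B.integral_normed
  set c := ∫ s in Ioo (0 : ℝ) 1, v s * ψ s with hc
  refine ⟨c, ?_⟩
  have key : ∀ φ : ℝ → ℝ, ContDiff ℝ ∞ φ → HasCompactSupport φ → tsupport φ ⊆ Ioo (0 : ℝ) 1 →
      ∫ x, φ x • (v x - c) = 0 := by
    intro φ h1 h2 h3
    set k := ∫ s, φ s with hk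
    have hφi : Integrable φ := h1.continuous.integrable_of_hasCompactSupport h2
    have hψi : Integrable ψ := hψ1.continuous.integrable_of_hasCompactSupport hψ2
    obtain ⟨Φ, e1, e2, e3, e4⟩ := exists_test_primitive (χ := fun s => φ s - k * ψ s)
      (h1.sub (contDiff_const.mul hψ1)) (h2.sub hψ2.mul_left)
      ((tsupport_sub _ _).trans (union_subset h3 ((tsupport_mul_subset_right).trans hψ3)))
      (by rw [integral_sub hφi (hψi.const_mul k), integral_const_mul, hψ4, hk]; ring)
    have h0 := h Φ e1 e2 e3
    rw [e4] at h0
    have i1 := integrableOn_mul_test hvi h1.continuous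
    have i2 := integrableOn_mul_test hvi hψ1.continuous
    have e5 : ∫ s in Ioo (0 : ℝ) 1, v s * (φ s - k * ψ s)
        = (∫ s in Ioo (0 : ℝ) 1, v s * φ s) - k * c := by
      rw [hc, ← integral_const_mul, ← integral_sub i1 (i2.const_mul k)]
      congr 1; ext s; ring
    rw [e5] at h0
    simp only [zero_mul, integral_zero, neg_zero] at h0
    have e6 : ∫ x, φ x • (v x - c) = ∫ x in Ioo (0 : ℝ) 1, (v x - c) * φ x := by
      rw [setIntegral_mul_of_tsupport h3]
      congr 1; ext s; simp [mul_comm]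
    have e7 : ∫ x in Ioo (0 : ℝ) 1, (v x - c) * φ x
        = (∫ s in Ioo (0 : ℝ) 1, v s * φ s) - ∫ s in Ioo (0 : ℝ) 1, c * φ s := by
      rw [← integral_sub i1 (hφi.integrableOn.const_mul c)]
      congr 1; ext s; ring
    rw [e6, e7, setIntegral_mul_of_tsupport h3 (f := fun _ => c), integral_const_mul]
    linarith
  have hae := isOpen_Ioo.ae_eq_zero_of_integral_contDiff_smul_eq_zero (μ := volume)
    (f := fun x => v x - c) (U := Ioo (0 : ℝ) 1)
    (((hv.mono Ioo_subset_Icc_self).sub continuousOn_const).locallyIntegrableOn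
      measurableSet_Ioo) key
  have : v =ᵐ[volume.restrict (Icc (0 : ℝ) 1)] fun _ => c := by
    rw [Measure.restrict_congr_set Ioo_ae_eq_Icc.symm]
    rw [Filter.EventuallyEq, ae_restrict_iff' measurableSet_Ioo]
    filter_upwards [hae] with x hx hxI
    linarith [hx hxI]
  exact Measure.eqOn_Icc_of_ae_eq volume zero_ne_one this hv continuousOn_const

/-- The primitive of an integrable function has that function as a weak derivative. -/
theorem hasWeakDeriv_primitive {g : ℝ → ℝ} (hg : IntegrableOn g (Ioo (0 : ℝ) 1)) :
    HasWeakDeriv (fun s => ∫ t in (0 : ℝ)..s, g t) g := by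
  intro φ h1 h2 h3
  have hgi : IntervalIntegrable g volume 0 1 := by
    rw [intervalIntegrable_iff_integrableOn_Ioo_of_le zero_le_one]; exact hg
  have hac := hgi.absolutelyContinuousOnInterval_intervalIntegral (c := 0) (by simp)
  have hφac : AbsolutelyContinuousOnInterval φ 0 1 :=
    ContDiffOn.absolutelyContinuousOnInterval (h1.of_le (by norm_num)).contDiffOn
  have hp := hac.integral_mul_deriv_eq_deriv_mul hφac
  have z0 : φ 0 = 0 := image_eq_zero_of_notMem_tsupport fun h => by simpa using h3 h
  have z1 : φ 1 = 0 := image_eq_zero_of_notMem_tsupport fun h => by simpa using h3 h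
  rw [z0, z1, mul_zero, mul_zero, sub_zero, zero_sub] at hp
  simp only [integral_Ioc_eq_integral_Ioo.symm,
    ← intervalIntegral.integral_of_le (zero_le_one' ℝ)]
  rw [hp]
  congr 1
  apply intervalIntegral.integral_congr_ae
  filter_upwards [hgi.ae_hasDerivAt_integral] with x hx hxI
  rw [(hx (uIoc_subset_uIcc hxI) 0 (by simp)).deriv]

theorem HasWeakDeriv.sub {v w g k : ℝ → ℝ} (hv : IntegrableOn v (Ioo (0 : ℝ) 1))
    (hw : IntegrableOn w (Ioo (0 : ℝ) 1)) (hg : IntegrableOn g (Ioo (0 : ℝ) 1))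
    (hk : IntegrableOn k (Ioo (0 : ℝ) 1)) (h1 : HasWeakDeriv v g) (h2 : HasWeakDeriv w k) :
    HasWeakDeriv (fun s => v s - w s) (fun s => g s - k s) := by
  intro φ a b c
  have hd : Continuous (deriv φ) := (contDiff_infty_iff_deriv.1 a).2.continuous
  simp only [sub_mul]
  rw [integral_sub (integrableOn_mul_test hv hd) (integrableOn_mul_test hw hd),
    integral_sub (integrableOn_mul_test hg a.continuous) (integrableOn_mul_test hk a.continuous),
    h1 φ a b c, h2 φ a b c]
  ring

theorem HasWeakDeriv.add {v w g k : ℝ → ℝ} (hv : IntegrableOn v (Ioo (0 : ℝ) 1))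
    (hw : IntegrableOn w (Ioo (0 : ℝ) 1)) (hg : IntegrableOn g (Ioo (0 : ℝ) 1))
    (hk : IntegrableOn k (Ioo (0 : ℝ) 1)) (h1 : HasWeakDeriv v g) (h2 : HasWeakDeriv w k) :
    HasWeakDeriv (fun s => v s + w s) (fun s => g s + k s) := by
  intro φ a b c
  have hd : Continuous (deriv φ) := (contDiff_infty_iff_deriv.1 a).2.continuous
  simp only [add_mul]
  rw [integral_add (integrableOn_mul_test hv hd) (integrableOn_mul_test hw hd),
    integral_add (integrableOn_mul_test hg a.continuous) (integrableOn_mul_test hk a.continuous),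
    h1 φ a b c, h2 φ a b c]
  ring

theorem HasWeakDeriv.const_mul {v g : ℝ → ℝ} (c : ℝ) (h : HasWeakDeriv v g) :
    HasWeakDeriv (fun s => c * v s) (fun s => c * g s) := by
  intro φ h1 h2 h3
  simp only [mul_assoc, integral_const_mul]
  rw [h φ h1 h2 h3]
  ring

theorem HasWeakDeriv.congr {v g k : ℝ → ℝ} (h : HasWeakDeriv v g)
    (hgk : g =ᵐ[volume.restrict (Ioo (0 : ℝ) 1)] k) : HasWeakDeriv v k := by
  intro φ h1 h2 h3
  rw [h φ h1 h2 h3]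
  congr 1
  apply integral_congr_ae
  filter_upwards [hgk] with x hx
  rw [hx]

theorem L2I.integrableOn (g : L2I) : IntegrableOn g (Ioo (0 : ℝ) 1) :=
  (Lp.memLp g).integrable (by norm_num)

theorem HasWeakDeriv.unique {v : ℝ → ℝ} {g k : L2I} (h1 : HasWeakDeriv v g)
    (h2 : HasWeakDeriv v k) : g = k := by
  apply Lp.ext
  have hi : IntegrableOn (fun s => g s - k s) (Ioo (0 : ℝ) 1) :=
    (L2I.integrableOn g).sub (L2I.integrableOn k)
  have hae := isOpen_Ioo.ae_eq_zero_of_integral_contDiff_smul_eq_zero (μ := volume)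
    (f := fun x => g x - k x) (U := Ioo (0 : ℝ) 1) hi.locallyIntegrableOn (by
      intro φ a b c
      have e : ∫ x, φ x • (g x - k x) = ∫ x in Ioo (0 : ℝ) 1, (g x - k x) * φ x := by
        rw [setIntegral_mul_of_tsupport c]
        congr 1; ext s; simp [mul_comm]
      have e1 := h1 φ a b c
      have e2 := h2 φ a b c
      simp only [e, sub_mul]
      rw [integral_sub (integrableOn_mul_test (L2I.integrableOn g) a.continuous)
        (integrableOn_mul_test (L2I.integrableOn k) a.continuous)]
      linarith)
  rw [Filter.EventuallyEq, ae_restrict_iff' measurableSet_Ioo]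
  filter_upwards [hae] with x hx hxI
  linarith [hx hxI]

/-- Continuous functions on `[0,1]`, extended to `ℝ` by constants, for use in integrals. -/
abbrev ext01 (v : C(Icc (0 : ℝ) 1, ℝ)) : ℝ → ℝ := fun s => v (projIcc 0 1 zero_le_one s)

theorem continuous_ext01 (v : C(Icc (0 : ℝ) 1, ℝ)) : Continuous (ext01 v) :=
  v.continuous.comp continuous_projIcc

theorem integrableOn_ext01 (v : C(Icc (0 : ℝ) 1, ℝ)) : IntegrableOn (ext01 v) (Ioo (0 : ℝ) 1) :=
  (continuous_ext01 v).continuousOn.integrableOn_Icc.mono_set Ioo_subset_Icc_self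

/-- `H¹_{0L}(I) = {v ∈ H¹(I) : v(0) = 0}` as a space of functions, each `v ∈ H¹(I)` being
identified with its continuous representative on `[0,1]`: the continuous functions on `[0,1]`
vanishing at `0` that have a weak derivative in `L²(I)`. -/
def H1LSubmodule : Submodule ℝ C(Icc (0 : ℝ) 1, ℝ) where
  carrier := {v | ext01 v 0 = 0 ∧ ∃ g : L2I, HasWeakDeriv (ext01 v) g}
  add_mem' := by
    rintro v w ⟨hv, g, hg⟩ ⟨hw, k, hk⟩
    refine ⟨?_, g + k, ?_⟩
    · change ext01 v 0 + ext01 w 0 = 0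
      rw [hv, hw, add_zero]
    exact (hg.add (integrableOn_ext01 v) (integrableOn_ext01 w) g.integrableOn k.integrableOn
      hk).congr (Lp.coeFn_add g k).symm
  zero_mem' := ⟨rfl, 0, by
    intro φ _ _ _
    have : (fun s => (0 : L2I) s * φ s) =ᵐ[volume.restrict (Ioo (0 : ℝ) 1)] fun _ => 0 := by
      filter_upwards [Lp.coeFn_zero ℝ 2 (volume.restrict (Ioo (0 : ℝ) 1))] with x hx
      rw [hx, Pi.zero_apply, zero_mul]
    rw [integral_congr_ae this]
    simp⟩
  smul_mem' := by
    rintro c v ⟨hv, g, hg⟩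
    refine ⟨?_, c • g, ?_⟩
    · change c * ext01 v 0 = 0
      rw [hv, mul_zero]
    exact (hg.const_mul c).congr (Lp.coeFn_smul c g).symm

/-- The space `H¹_{0L}(I)`; it carries the norm `‖v‖² = ∫ (v')²` and not the uniform norm. -/
def H1L : Type := ↥H1LSubmodule

namespace H1L

instance : AddCommGroup H1L := inferInstanceAs (AddCommGroup ↥H1LSubmodule)

instance : Module ℝ H1L := inferInstanceAs (Module ℝ ↥H1LSubmodule)

/-- The values of `v ∈ H¹_{0L}(I)` on `[0,1]` (extended by constants outside `[0,1]`). -/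
def eval (v : H1L) : ℝ → ℝ := ext01 (Subtype.val v)

instance : CoeFun H1L (fun _ => ℝ → ℝ) := ⟨eval⟩

theorem add_apply (v w : H1L) (s : ℝ) : (v + w) s = v s + w s := rfl

theorem smul_apply (c : ℝ) (v : H1L) (s : ℝ) : (c • v) s = c * v s := rfl

theorem continuous (v : H1L) : Continuous v := continuous_ext01 v.1

theorem integrableOn (v : H1L) : IntegrableOn v (Ioo (0 : ℝ) 1) := integrableOn_ext01 v.1

theorem apply_zero (v : H1L) : v 0 = 0 :=
  v.2.1

theorem ext_of_eqOn {v w : H1L} (h : ∀ s ∈ Icc (0 : ℝ) 1, v s = w s) : v = w := by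
  apply Subtype.ext
  ext s
  have h1 := h s s.2
  change v.1 (projIcc 0 1 zero_le_one s) = w.1 (projIcc 0 1 zero_le_one s) at h1
  rwa [projIcc_val] at h1

/-- The weak derivative `v' ∈ L²(I)` of `v ∈ H¹_{0L}(I)`. -/
def D (v : H1L) : L2I := v.2.2.choose

theorem hasWeakDeriv (v : H1L) : HasWeakDeriv v v.D := v.2.2.choose_spec

theorem D_eq {v : H1L} {g : L2I} (h : HasWeakDeriv v g) : v.D = g := v.hasWeakDeriv.unique h

theorem D_add (v w : H1L) : (v + w).D = v.D + w.D :=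
  D_eq ((v.hasWeakDeriv.add (integrableOn_ext01 v.1) (integrableOn_ext01 w.1) v.D.integrableOn
      w.D.integrableOn w.hasWeakDeriv).congr (Lp.coeFn_add _ _).symm)

theorem D_smul (c : ℝ) (v : H1L) : (c • v).D = c • v.D :=
  D_eq ((v.hasWeakDeriv.const_mul c).congr (Lp.coeFn_smul c _).symm)

/-- `v(s) = ∫₀ˢ v'`. -/
theorem apply_eq_integral (v : H1L) {s : ℝ} (hs : s ∈ Icc (0 : ℝ) 1) :
    v s = ∫ t in (0 : ℝ)..s, v.D t := by
  have hgi : IntervalIntegrable v.D volume 0 1 := by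
    rw [intervalIntegrable_iff_integrableOn_Ioo_of_le zero_le_one]; exact v.D.integrableOn
  have hc : ContinuousOn (fun s => ∫ t in (0 : ℝ)..s, v.D t) (Icc 0 1) := by
    have := (hgi.absolutelyContinuousOnInterval_intervalIntegral (c := 0) (by simp)).continuousOn
    rwa [uIcc_of_le zero_le_one] at this
  have hw := v.hasWeakDeriv.sub (integrableOn_ext01 v.1)
    (hc.integrableOn_Icc.mono_set Ioo_subset_Icc_self) v.D.integrableOn v.D.integrableOn
    (hasWeakDeriv_primitive v.D.integrableOn)
  simp only [sub_self] at hw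
  obtain ⟨c, h⟩ := hw.exists_const (v.continuous.continuousOn.sub hc)
  have h0 := h 0 (by simp)
  have h1 := h s hs
  have h2 := v.apply_zero
  simp only [Pi.sub_apply, intervalIntegral.integral_same] at h0 h1
  linarith

/-- The linear map `v ↦ v'`. -/
def DLin : H1L →ₗ[ℝ] L2I where
  toFun := D
  map_add' := D_add
  map_smul' := D_smul

theorem DLin_injective : Function.Injective DLin := by
  rw [injective_iff_map_eq_zero]
  intro v hv
  apply ext_of_eqOn
  intro s hs
  have hv' : v.D = 0 := hv
  have h0 : (0 : H1L) s = 0 := rfl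
  rw [v.apply_eq_integral hs, hv', h0, intervalIntegral.integral_of_le hs.1,
    integral_Ioc_eq_integral_Ioo]
  have : ((0 : L2I) : ℝ → ℝ) =ᵐ[volume.restrict (Ioo (0 : ℝ) s)] fun _ => 0 :=
    ae_restrict_of_ae_restrict_of_subset (Ioo_subset_Ioo_right hs.2)
      (Lp.coeFn_zero ℝ 2 (volume.restrict (Ioo (0 : ℝ) 1)))
  rw [integral_congr_ae this]
  simp

/-- The norm `‖v‖ = ‖v'‖_{L²(I)}`. -/
instance : NormedAddCommGroup H1L := NormedAddCommGroup.induced H1L L2I DLin DLin_injective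

theorem norm_eq (v : H1L) : ‖v‖ = ‖v.D‖ := rfl

theorem integral_D_mul_D (u v : H1L) :
    ∫ s in Ioo (0 : ℝ) 1, u.D s * v.D s = inner ℝ u.D v.D := by
  rw [L2.inner_def]
  congr 1; ext s
  rw [real_inner_eq_re_inner, RCLike.inner_apply]
  simp [mul_comm]

/-- The Hilbert space structure with scalar product `∫ u' v'`. -/
instance : InnerProductSpace ℝ H1L where
  toNormedSpace := NormedSpace.induced ℝ H1L L2I DLin
  inner u v := ∫ s in Ioo (0 : ℝ) 1, u.D s * v.D s
  norm_sq_eq_re_inner v := by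
    rw [integral_D_mul_D, norm_eq, ← real_inner_self_eq_norm_sq]
    rfl
  conj_inner_symm u v := by simp [mul_comm]
  add_left u v w := by
    simp only [integral_D_mul_D]
    rw [D_add, inner_add_left]
  smul_left u v r := by
    simp only [integral_D_mul_D]
    rw [D_smul, inner_smul_left]

theorem abs_apply_le (v : H1L) (s : ℝ) : |v s| ≤ ‖v‖ := by
  have : IsProbabilityMeasure (volume.restrict (Ioo (0 : ℝ) 1)) := ⟨by simp⟩
  have h1 : ∫ t in Ioo (0 : ℝ) 1, ‖v.D t‖ ≤ ‖v‖ := by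
    rw [norm_eq, Lp.norm_def, integral_norm_eq_lintegral_enorm v.D.integrableOn.1,
      ← eLpNorm_one_eq_lintegral_enorm]
    exact ENNReal.toReal_mono (Lp.memLp v.D).2.ne
      (eLpNorm_le_eLpNorm_of_exponent_le (by norm_num) v.D.integrableOn.1)
  set r : Icc (0 : ℝ) 1 := projIcc 0 1 zero_le_one s with hr
  have h2 : v s = v r := by
    simp only [eval, ext01, projIcc_val, hr]
  rw [h2, v.apply_eq_integral r.2, intervalIntegral.integral_of_le r.2.1,
    integral_Ioc_eq_integral_Ioo, ← Real.norm_eq_abs]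
  refine (norm_integral_le_integral_norm _).trans (le_trans ?_ h1)
  exact setIntegral_mono_set v.D.integrableOn.norm (Filter.Eventually.of_forall fun _ => norm_nonneg _)
    (Ioo_subset_Ioo_right r.2.2).eventuallyLE

end H1L

/-- Vectors of `ℝ²` with the Euclidean norm. -/
abbrev R2 : Type := EuclideanSpace ℝ (Fin 2)

/-- `Dm(v) = (-sin v, cos v)`, the derivative of `m(v) = (cos v, sin v)`. -/
def Dm (v : ℝ) : R2 := !₂[-Real.sin v, Real.cos v]

/-- `D²m(v) = (-cos v, -sin v)`, the second derivative of `m(v) = (cos v, sin v)`. -/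
def D2m (v : ℝ) : R2 := !₂[-Real.cos v, -Real.sin v]

theorem norm_Dm (v : ℝ) : ‖Dm v‖ = 1 := by
  simp [Dm, EuclideanSpace.norm_eq]

theorem continuous_Dm : Continuous Dm := by
  unfold Dm
  fun_prop

/-- The admissible space `ℝ²ⁿ × H¹_{0L}(I) × H¹_{0L}(I)ⁿ` of triples `(h, α, ϑ)`. It carries the
maximum of the norms of the components, which is equivalent to their sum. -/
abbrev Config (n : ℕ) : Type := (Fin n → R2) × H1L × (Fin n → H1L)

/-- `v ∈ H¹_{0L}(I)` is a weak solution of `-c v'' + f = 0` in `I`, `c v(0) = c v'(1) = 0`. -/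
def IsWeakSolution (c : ℝ) (f : ℝ → ℝ) (v : H1L) : Prop :=
  ∀ w : H1L, c * (∫ s in Ioo (0 : ℝ) 1, v.D s * w.D s) + (∫ s in Ioo (0 : ℝ) 1, f s * w s) = 0

/-- `v ∈ H¹_{0L}(I)` satisfies `-c v'' + f = 0` a.e. in `I` and `c v'(1) = 0` pointwise:
`c v` is of class `C¹` on `[0,1]`, its derivative `q = c v'` has the weak derivative `f`,
and `q(1) = 0`. -/
def IsStrongSolution (c : ℝ) (f : ℝ → ℝ) (v : H1L) : Prop :=
  ∃ q : ℝ → ℝ, ContinuousOn q (Icc (0 : ℝ) 1) ∧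
    (∀ s ∈ Icc (0 : ℝ) 1, HasDerivWithinAt (fun t => c * v t) (q s) (Icc (0 : ℝ) 1) s) ∧
    HasWeakDeriv q f ∧ q 1 = 0

/-- The zero-order term of the state equation `-ϑ'' - h · Dm(α + ϑ) = 0`. -/
def stateTerm (h : R2) (α ϑ : H1L) (s : ℝ) : ℝ := -inner ℝ h (Dm (α s + ϑ s))

/-- The coefficient `h · D²m(α + ϑ)` of the linearized state equation. -/
def linCoeff (h : R2) (α ϑ : H1L) (s : ℝ) : ℝ := inner ℝ h (D2m (α s + ϑ s))

/-- The admissible set: the triples such that every `ϑᵢ` solves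
`-ϑᵢ'' - hᵢ · Dm(α + ϑᵢ) = 0` in `I`, `ϑᵢ(0) = ϑᵢ'(1) = 0`. -/
def admissible (n : ℕ) : Set (Config n) :=
  {p | ∀ i, IsWeakSolution 1 (stateTerm (p.1 i) p.2.1 (p.2.2 i)) (p.2.2 i)}

/-- The cost functional
`½ ∑ ∫ |ϑᵢ - ϑ̄ᵢ|² + (ε/2) ∫ |α'|² + (γ/2) ∑ |hᵢ|²`. -/
def cost {n : ℕ} (ε γ : ℝ) (ϑbar : Fin n → L2I) (p : Config n) : ℝ :=
  1 / 2 * ∑ i, (∫ s in Ioo (0 : ℝ) 1, (p.2.2 i s - ϑbar i s) ^ 2)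
    + ε / 2 * (∫ s in Ioo (0 : ℝ) 1, (p.2.1.D s) ^ 2) + γ / 2 * ∑ i, ‖p.1 i‖ ^ 2

/-- `p` minimizes the cost functional in the admissible set. -/
def IsMinimizer {n : ℕ} (ε γ : ℝ) (ϑbar : Fin n → L2I) (p : Config n) : Prop :=
  p ∈ admissible n ∧ ∀ q ∈ admissible n, cost ε γ ϑbar p ≤ cost ε γ ϑbar q

theorem continuous_stateTerm (h : R2) (α ϑ : H1L) : Continuous (stateTerm h α ϑ) := by
  unfold stateTerm
  exact (continuous_const.inner
    (continuous_Dm.comp (α.continuous.add ϑ.continuous))).neg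

theorem abs_stateTerm_le (h : R2) (α ϑ : H1L) (s : ℝ) : |stateTerm h α ϑ s| ≤ ‖h‖ := by
  unfold stateTerm
  rw [abs_neg]
  refine (abs_real_inner_le_norm _ _).trans ?_
  rw [norm_Dm, mul_one]

theorem integrableOn_stateTerm_mul (h : R2) (α ϑ w : H1L) :
    IntegrableOn (fun s => inner ℝ h (Dm (α s + ϑ s)) * w s) (Ioo (0 : ℝ) 1) := by
  have : IntegrableOn (fun s => stateTerm h α ϑ s * w s) (Ioo (0 : ℝ) 1) :=
    ((continuous_stateTerm h α ϑ).mul w.continuous).continuousOn.integrableOn_Icc.mono_set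
      Ioo_subset_Icc_self
  simpa [stateTerm] using this.neg

/-- The constraint map `G` from the admissible space to the dual of `H¹_{0L}(I)ⁿ`:
`⟨G(h, α, ϑ), u⟩ = ∑ {∫ ϑᵢ' uᵢ' - ∫ hᵢ · Dm(α + ϑᵢ) uᵢ}`. -/
def constraintMap {n : ℕ} (p : Config n) : StrongDual ℝ (Fin n → H1L) :=
  LinearMap.mkContinuous
    { toFun := fun u => ∑ i, ((∫ s in Ioo (0 : ℝ) 1, (p.2.2 i).D s * (u i).D s)
        - ∫ s in Ioo (0 : ℝ) 1, inner ℝ (p.1 i) (Dm (p.2.1 s + p.2.2 i s)) * u i s)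
      map_add' := by
        intro u w
        rw [← Finset.sum_add_distrib]
        refine Finset.sum_congr rfl fun i _ => ?_
        simp only [Pi.add_apply, H1L.integral_D_mul_D, H1L.add_apply, mul_add]
        rw [H1L.D_add, inner_add_right,
          integral_add (integrableOn_stateTerm_mul _ _ _ _) (integrableOn_stateTerm_mul _ _ _ _)]
        ring
      map_smul' := by
        intro c u
        rw [RingHom.id_apply, smul_eq_mul, Finset.mul_sum]
        refine Finset.sum_congr rfl fun i _ => ?_
        simp only [Pi.smul_apply, H1L.integral_D_mul_D, H1L.smul_apply, mul_left_comm _ c,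
          integral_const_mul]
        rw [H1L.D_smul, inner_smul_right]
        ring }
    (∑ i, (‖p.2.2 i‖ + ‖p.1 i‖)) (by
      intro u
      rw [LinearMap.coe_mk, AddHom.coe_mk, Finset.sum_mul]
      refine (norm_sum_le _ _).trans (Finset.sum_le_sum fun i _ => ?_)
      rw [add_mul, H1L.integral_D_mul_D]
      refine (norm_sub_le _ _).trans (add_le_add ?_ ?_)
      · refine (norm_inner_le_norm _ _).trans ?_
        exact mul_le_mul_of_nonneg_left (norm_le_pi_norm u i) (norm_nonneg _)
      · have hb : ∀ s ∈ Ioo (0 : ℝ) 1,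
            ‖inner ℝ (p.1 i) (Dm (p.2.1 s + p.2.2 i s)) * u i s‖ ≤ ‖p.1 i‖ * ‖u‖ := by
          intro s _
          rw [norm_mul]
          refine mul_le_mul ?_ (((u i).abs_apply_le s).trans (norm_le_pi_norm u i))
            (norm_nonneg _) (norm_nonneg _)
          have := abs_stateTerm_le (p.1 i) p.2.1 (p.2.2 i) s
          rwa [stateTerm, abs_neg] at this
        have := norm_setIntegral_le_of_norm_le_const (μ := volume) (by simp) hb
        simpa using this)

/-- `p` is a regular point: the constraint map is Fréchet differentiable at `p` and its
differential is surjective. -/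
def IsRegularPoint {n : ℕ} (p : Config n) : Prop :=
  DifferentiableAt ℝ (constraintMap (n := n)) p ∧
    Function.Surjective (fderiv ℝ (constraintMap (n := n)) p)

/-- `μ` is an eigenvalue of `-u'' + q u = μ r u` in `I`, `u(0) = u'(1) = 0`: this problem has a
nonzero weak solution. -/
def IsSLEigenvalue (q r : ℝ → ℝ) (μ : ℝ) : Prop :=
  ∃ u : H1L, u ≠ 0 ∧ IsWeakSolution 1 (fun s => q s * u s - μ * (r s * u s)) u

/-- The constant `c_p = 2/π` of the Poincaré inequality `∫ v² ≤ c_p² ∫ (v')²` in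
`H¹_{0L}(I)`. -/
def cP : ℝ := 2 / Real.pi

/-- `λ ∈ H¹_{0L}(I)ⁿ` is a Lagrange multiplier at `p`: the differential of the cost at `p` is
`ψ ↦ ⟨DG(p) ψ, λ⟩`. -/
def IsLagrangeMultiplier {n : ℕ} (ε γ : ℝ) (ϑbar : Fin n → L2I) (p : Config n)
    (lam : Fin n → H1L) : Prop :=
  HasFDerivAt (cost ε γ ϑbar)
    ((ContinuousLinearMap.apply ℝ ℝ lam).comp (fderiv ℝ (constraintMap (n := n)) p)) p

/-- `v` solves `-c v'' + f = 0` in `I`, `c v(0) = c v'(1) = 0`: it is a weak solution, satisfies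
the equation almost everywhere and the boundary conditions pointwise. -/
def SolvesBVP (c : ℝ) (f : ℝ → ℝ) (v : H1L) : Prop :=
  IsWeakSolution c f v ∧ IsStrongSolution c f v

/-- `(h, α, ϑ, λ)` solves the optimality system. -/
structure SolvesEQ {n : ℕ} (ε γ : ℝ) (ϑbar : Fin n → L2I) (h : Fin n → R2) (α : H1L)
    (ϑ lam : Fin n → H1L) : Prop where
  /-- `-ϑᵢ'' - hᵢ · Dm(α + ϑᵢ) = 0`, `ϑᵢ(0) = ϑᵢ'(1) = 0`. -/
  state : ∀ i, SolvesBVP 1 (stateTerm (h i) α (ϑ i)) (ϑ i)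
  /-- `-λᵢ'' - λᵢ hᵢ · D²m(α + ϑᵢ) = ϑᵢ - ϑ̄ᵢ`, `λᵢ(0) = λᵢ'(1) = 0`. -/
  adjoint : ∀ i, SolvesBVP 1
    (fun s => -(lam i s * linCoeff (h i) α (ϑ i) s) - (ϑ i s - ϑbar i s)) (lam i)
  /-- `-ε α'' + ∑ λᵢ hᵢ · D²m(α + ϑᵢ) = 0`, `ε α(0) = ε α'(1) = 0`. -/
  design : SolvesBVP ε (fun s => ∑ i, lam i s * linCoeff (h i) α (ϑ i) s) α
  /-- `γ hᵢ = -∫ λᵢ Dm(α + ϑᵢ)`. -/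
  field : ∀ i, γ • h i = -∫ s in Ioo (0 : ℝ) 1, lam i s • Dm (α s + ϑ i s)

end

end MagElastica

open MagElastica

/-!
The constraint map is built from continuous linear maps and the superposition operators
`f ↦ sin ∘ f`, `f ↦ cos ∘ f` on `C([0,1])`, which are of class `C¹` because sine and cosine have
Lipschitz continuous derivatives (`hasFDerivAt_comp_left`). Since `H¹_{0L}(I)` embeds into
`C([0,1])`, it follows that `G` is of class `C¹`, with the differential computed in
`fderiv_constraintMap_apply`.

*Regularity.* Varying only `ϑ`, the differential of `G` splits into the linearized state operators
`u ↦ -u'' - hᵢ · D²m(α + ϑᵢ) u`. Each is the identity minus a compact operator, as the embedding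
`H¹_{0L}(I) → C([0,1])` is compact by the theorem of Arzelà and Ascoli
(`H1L.isCompactOperator_toC`). By the Fredholm alternative it is onto as soon as it is injective
(`exists_sub_loadForm_eq`). The condition on the eigenvalue `μ = 1` is injectivity, since
`r⁺ - r⁻ = r`. For small fields, injectivity is a consequence of the Poincaré inequality with
constants arbitrarily close to `2/π`, which is proved by completing a square with the solution
`a tan(a(1 - s))` of a Riccati equation (`H1L.sq_mul_integral_sq_le`).

*Optimality system.* At a regular minimizer the Lagrange multiplier rule gives an algebraic
functional on the dual of `H¹_{0L}(I)ⁿ`; it is continuous by the open mapping theorem, and by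
reflexivity it is the evaluation at some `λ` (`exists_lagrangeMultiplier`). Varying `ϑᵢ`, `α` and
`hᵢ` separately yields the equations in weak form. A weak solution of `-c v'' + f = 0` satisfies
`c v'(s) = ∫₀ˢ f - ∫₀¹ f` everywhere, because weak derivatives exhaust `L²(I)`
(`IsWeakSolution.hasDerivWithinAt`). In particular `ε α'(0) = -∑ ∫ λᵢ hᵢ · D²m(α + ϑᵢ)`, and this
vanishes: `D²m` is `Dm` rotated by a right angle, so the field equation turns each
integral into `γ` times the scalar product of `hᵢ` with its own rotation.
-/

namespace MagElastica

noncomputable section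

-- Nested instance problems, such as the topology of the dual of a power of `H1L`, need this depth.
set_option maxSynthPendingDepth 3

/-! ### Continuous functions and `H¹_{0L}(I)` inside `L²(I)` -/

theorem integrableOn_of_continuous {f : ℝ → ℝ} (hf : Continuous f) :
    IntegrableOn f (Ioo (0 : ℝ) 1) :=
  hf.continuousOn.integrableOn_Icc.mono_set Ioo_subset_Icc_self

theorem L2I.intervalIntegrable (g : L2I) : IntervalIntegrable g volume 0 1 := by
  rw [intervalIntegrable_iff_integrableOn_Ioo_of_le zero_le_one]
  exact g.integrableOn

theorem isProbabilityMeasure_Ioo01 :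
    IsProbabilityMeasure (volume.restrict (Ioo (0 : ℝ) 1)) := ⟨by simp⟩

theorem abs_ext01_le (f : C(Icc (0 : ℝ) 1, ℝ)) (s : ℝ) : |ext01 f s| ≤ ‖f‖ :=
  f.norm_coe_le_norm _

theorem memLp_ext01 (f : C(Icc (0 : ℝ) 1, ℝ)) :
    MemLp (ext01 f) 2 (volume.restrict (Ioo (0 : ℝ) 1)) := by
  have := isProbabilityMeasure_Ioo01
  exact MemLp.of_bound (continuous_ext01 f).aestronglyMeasurable ‖f‖
    (Filter.Eventually.of_forall (abs_ext01_le f))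

/-- The inclusion of `C([0,1])` into `L²(I)`. -/
def extL2 : C(Icc (0 : ℝ) 1, ℝ) →L[ℝ] L2I :=
  LinearMap.mkContinuous
    { toFun := fun f => (memLp_ext01 f).toLp (ext01 f)
      map_add' := fun f g => MemLp.toLp_add (memLp_ext01 f) (memLp_ext01 g)
      map_smul' := fun c f => MemLp.toLp_const_smul c (memLp_ext01 f) } 1 (by
      intro f
      have := isProbabilityMeasure_Ioo01
      have h := Lp.norm_le_of_ae_bound (f := (memLp_ext01 f).toLp (ext01 f)) (norm_nonneg f) (by
        filter_upwards [(memLp_ext01 f).coeFn_toLp] with s hs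
        rw [hs]
        exact abs_ext01_le f s)
      have h1 : measureUnivNNReal (volume.restrict (Ioo (0 : ℝ) 1)) = 1 := by
        simp [measureUnivNNReal]
      rw [h1, NNReal.coe_one, Real.one_rpow] at h
      exact h)

theorem coeFn_extL2 (f : C(Icc (0 : ℝ) 1, ℝ)) :
    extL2 f =ᵐ[volume.restrict (Ioo (0 : ℝ) 1)] ext01 f :=
  (memLp_ext01 f).coeFn_toLp

theorem inner_L2I (f g : L2I) : inner ℝ f g = ∫ s in Ioo (0 : ℝ) 1, f s * g s := by
  rw [L2.inner_def]
  congr 1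
  ext s
  rw [real_inner_eq_re_inner, RCLike.inner_apply]
  simp [mul_comm]

theorem inner_extL2_left (f : C(Icc (0 : ℝ) 1, ℝ)) (g : L2I) :
    inner ℝ (extL2 f) g = ∫ s in Ioo (0 : ℝ) 1, ext01 f s * g s := by
  rw [inner_L2I]
  apply integral_congr_ae
  filter_upwards [coeFn_extL2 f] with s hs
  rw [hs]

theorem inner_extL2 (f g : C(Icc (0 : ℝ) 1, ℝ)) :
    inner ℝ (extL2 f) (extL2 g) = ∫ s in Ioo (0 : ℝ) 1, ext01 f s * ext01 g s := by
  rw [inner_extL2_left]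
  apply integral_congr_ae
  filter_upwards [coeFn_extL2 g] with s hs
  rw [hs]

namespace H1L

/-- The inclusion of `H¹_{0L}(I)` into `C([0,1])`. -/
def toC : H1L →L[ℝ] C(Icc (0 : ℝ) 1, ℝ) :=
  LinearMap.mkContinuous
    { toFun := fun v => Subtype.val v
      map_add' := fun _ _ => rfl
      map_smul' := fun _ _ => rfl } 1 (by
      intro v
      rw [one_mul]
      refine (ContinuousMap.norm_le _ (norm_nonneg v)).2 fun s => ?_
      have h := v.abs_apply_le s
      change |v.1 (projIcc 0 1 zero_le_one s)| ≤ ‖v‖ at h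
      rwa [projIcc_val] at h)

theorem toC_apply (v : H1L) (s : Icc (0 : ℝ) 1) : toC v s = v s := by
  change v.1 s = v.1 (projIcc 0 1 zero_le_one s)
  rw [projIcc_val]

/-- The inclusion of `H¹_{0L}(I)` into `L²(I)`. -/
def toL2 : H1L →L[ℝ] L2I := extL2.comp toC

theorem coeFn_toL2 (v : H1L) : toL2 v =ᵐ[volume.restrict (Ioo (0 : ℝ) 1)] v :=
  coeFn_extL2 (toC v)

theorem inner_toL2_right (f : L2I) (v : H1L) :
    inner ℝ f (toL2 v) = ∫ s in Ioo (0 : ℝ) 1, f s * v s := by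
  rw [inner_L2I]
  apply integral_congr_ae
  filter_upwards [coeFn_toL2 v] with s hs
  rw [hs]

theorem inner_extL2_toL2 (f : C(Icc (0 : ℝ) 1, ℝ)) (v : H1L) :
    inner ℝ (extL2 f) (toL2 v) = ∫ s in Ioo (0 : ℝ) 1, ext01 f s * v s :=
  inner_extL2 f (toC v)

theorem inner_eq_integral (u v : H1L) :
    inner ℝ u v = ∫ s in Ioo (0 : ℝ) 1, u.D s * v.D s := rfl

/-! ### Completeness of `H¹_{0L}(I)` -/

/-- Every `g ∈ L²(I)` is the weak derivative of its primitive vanishing at `0`. -/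
theorem D_surjective : Function.Surjective D := by
  intro g
  have hc : ContinuousOn (fun s => ∫ t in (0 : ℝ)..s, g t) (Icc 0 1) := by
    have := (g.intervalIntegrable.absolutelyContinuousOnInterval_intervalIntegral
      (c := 0) (by simp)).continuousOn
    rwa [uIcc_of_le zero_le_one] at this
  let f : C(Icc (0 : ℝ) 1, ℝ) := ⟨fun s => ∫ t in (0 : ℝ)..s, g t, hc.domRestrict⟩
  have hf : ∀ s ∈ Icc (0 : ℝ) 1, ext01 f s = ∫ t in (0 : ℝ)..s, g t := by
    intro s hs
    change ∫ t in (0 : ℝ)..(projIcc 0 1 zero_le_one s : ℝ), g t = _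
    rw [projIcc_of_mem zero_le_one hs]
  have hw : HasWeakDeriv (ext01 f) g := by
    intro φ h1 h2 h3
    rw [← hasWeakDeriv_primitive g.integrableOn φ h1 h2 h3]
    refine setIntegral_congr_fun measurableSet_Ioo fun s hs => ?_
    rw [hf s (Ioo_subset_Icc_self hs)]
  have hm : f ∈ H1LSubmodule := ⟨by rw [hf 0 (by simp)]; simp, g, hw⟩
  exact ⟨(⟨f, hm⟩ : H1LSubmodule), D_eq hw⟩

/-- Differentiation as an isometry of `H¹_{0L}(I)` onto `L²(I)`. -/
def DEquiv : H1L ≃ₗᵢ[ℝ] L2I :=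
  LinearIsometryEquiv.ofSurjective ⟨DLin, fun _ => rfl⟩ D_surjective

instance : CompleteSpace H1L :=
  (completeSpace_congr (e := DEquiv.toEquiv) DEquiv.isometry.isUniformEmbedding).2 inferInstance

/-! ### Compactness of the embedding into `C([0,1])` -/

/-- `H¹_{0L}(I)` embeds into the Hölder continuous functions of exponent `1/2`. -/
theorem abs_sub_le (v : H1L) {s t : ℝ} (hs : s ∈ Icc (0 : ℝ) 1) (ht : t ∈ Icc (0 : ℝ) 1) :
    |v t - v s| ≤ ‖v‖ * √|t - s| := by
  wlog hst : s ≤ t generalizing s t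
  · rw [abs_sub_comm (v t), abs_sub_comm t]
    exact this ht hs (le_of_not_ge hst)
  have hi : ∀ r ∈ Icc (0 : ℝ) 1, IntervalIntegrable v.D volume 0 r := fun r hr =>
    v.D.intervalIntegrable.mono_set (by
      rw [uIcc_of_le hr.1, uIcc_of_le zero_le_one]; exact Icc_subset_Icc_right hr.2)
  rw [v.apply_eq_integral hs, v.apply_eq_integral ht,
    intervalIntegral.integral_interval_sub_left (hi t ht) (hi s hs),
    intervalIntegral.integral_of_le hst, integral_Ioc_eq_integral_Ioo]
  have hsub : Ioo s t ⊆ Ioo (0 : ℝ) 1 := Ioo_subset_Ioo hs.1 ht.2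
  have hfin : (volume.restrict (Ioo (0 : ℝ) 1)) (Ioo s t) ≠ ⊤ := measure_ne_top _ _
  -- Cauchy–Schwarz with the indicator function of `(s, t)`
  have e : ∫ x in Ioo s t, v.D x
      = inner ℝ (indicatorConstLp 2 measurableSet_Ioo hfin (1 : ℝ)) v.D := by
    rw [L2.inner_indicatorConstLp_one measurableSet_Ioo hfin,
      Measure.restrict_restrict measurableSet_Ioo, inter_eq_self_of_subset_left hsub]
  rw [e]
  refine (abs_real_inner_le_norm _ _).trans ?_
  rw [mul_comm, norm_indicatorConstLp (by norm_num) (by norm_num), norm_eq v]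
  refine mul_le_mul_of_nonneg_left (le_of_eq ?_) (norm_nonneg _)
  rw [measureReal_restrict_apply measurableSet_Ioo, inter_eq_self_of_subset_left hsub,
    Real.volume_real_Ioo_of_le hst, abs_of_nonneg (sub_nonneg.2 hst), Real.sqrt_eq_rpow]
  simp

theorem isCompactOperator_toC : IsCompactOperator (toC : H1L → C(Icc (0 : ℝ) 1, ℝ)) := by
  let e := ContinuousMap.linearIsometryBoundedOfCompact (Icc (0 : ℝ) 1) ℝ ℝ
  suffices h : IsCompactOperator (fun v : H1L => e (toC v)) by
    have he : (toC : H1L → C(Icc (0 : ℝ) 1, ℝ)) = e.symm ∘ fun v => e (toC v) :=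
      funext fun v => (e.symm_apply_apply _).symm
    rw [he]
    exact h.continuous_comp e.symm.continuous
  rw [isCompactOperator_iff_exists_mem_nhds_isCompact_closure_image]
  refine ⟨Metric.closedBall 0 1, Metric.closedBall_mem_nhds _ one_pos, ?_⟩
  refine BoundedContinuousFunction.arzela_ascoli (Icc (-1 : ℝ) 1) isCompact_Icc _ ?_ ?_
  · rintro _ s ⟨v, hv, rfl⟩
    have h1 := v.abs_apply_le s
    rw [mem_closedBall_zero_iff] at hv
    have h2 : e (toC v) s = v s := toC_apply v s
    rw [h2]
    exact abs_le.1 (h1.trans hv)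
  · refine Metric.equicontinuous_of_continuity_modulus (fun d => √d) ?_ _ ?_
    · have := Real.continuous_sqrt.tendsto 0
      rwa [Real.sqrt_zero] at this
    · rintro s t ⟨_, v, hv, rfl⟩
      rw [mem_closedBall_zero_iff] at hv
      change dist (toC v s) (toC v t) ≤ _
      rw [toC_apply, toC_apply, Real.dist_eq, Subtype.dist_eq, Real.dist_eq]
      refine (v.abs_sub_le t.2 s.2).trans ?_
      exact mul_le_of_le_one_left (Real.sqrt_nonneg _) hv

end H1L

/-! ### From weak to strong solutions -/

/-- Integration by parts for the primitives of two integrable functions. -/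
theorem integral_primitive_mul {f g : ℝ → ℝ} (hf : IntervalIntegrable f volume 0 1)
    (hg : IntervalIntegrable g volume 0 1) :
    ∫ s in (0 : ℝ)..1, (∫ t in (0 : ℝ)..s, f t) * g s
      = (∫ t in (0 : ℝ)..1, f t) * (∫ t in (0 : ℝ)..1, g t)
        - ∫ s in (0 : ℝ)..1, f s * ∫ t in (0 : ℝ)..s, g t := by
  have hF := hf.absolutelyContinuousOnInterval_intervalIntegral (c := 0) (by simp)
  have hG := hg.absolutelyContinuousOnInterval_intervalIntegral (c := 0) (by simp)
  have h := hF.integral_mul_deriv_eq_deriv_mul hG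
  simp only [intervalIntegral.integral_same, mul_zero, sub_zero] at h
  have e1 : ∫ s in (0 : ℝ)..1, (∫ t in (0 : ℝ)..s, f t) * g s
      = ∫ s in (0 : ℝ)..1, (∫ t in (0 : ℝ)..s, f t) * deriv (fun x => ∫ t in (0 : ℝ)..x, g t) s := by
    apply intervalIntegral.integral_congr_ae
    filter_upwards [hg.ae_hasDerivAt_integral] with x hx hxI
    rw [(hx (uIoc_subset_uIcc hxI) 0 (by simp)).deriv]
  have e2 : ∫ s in (0 : ℝ)..1, f s * (∫ t in (0 : ℝ)..s, g t)
      = ∫ s in (0 : ℝ)..1, deriv (fun x => ∫ t in (0 : ℝ)..x, f t) s * ∫ t in (0 : ℝ)..s, g t := by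
    apply intervalIntegral.integral_congr_ae
    filter_upwards [hf.ae_hasDerivAt_integral] with x hx hxI
    rw [(hx (uIoc_subset_uIcc hxI) 0 (by simp)).deriv]
  rw [e1, e2, h]

theorem hasWeakDeriv_const (c : ℝ) : HasWeakDeriv (fun _ => c) (fun _ => 0) := by
  intro φ h1 h2 h3
  have z0 : φ 0 = 0 := image_eq_zero_of_notMem_tsupport fun h => by simpa using h3 h
  have z1 : φ 1 = 0 := image_eq_zero_of_notMem_tsupport fun h => by simpa using h3 h
  have hd : ∫ s in (0 : ℝ)..1, deriv φ s = φ 1 - φ 0 :=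
    intervalIntegral.integral_deriv_eq_sub
      (fun x _ => (h1.differentiable (by simp)).differentiableAt)
      ((contDiff_infty_iff_deriv.1 h1).2.continuous.intervalIntegrable _ _)
  rw [integral_const_mul, ← integral_Ioc_eq_integral_Ioo,
    ← intervalIntegral.integral_of_le zero_le_one, hd, z0, z1]
  simp

/-- A weak solution of `-c v'' + f = 0`, `c v'(1) = 0` satisfies `c v' = q` for the continuous
function `q(s) = ∫₀ˢ f - ∫₀¹ f`. -/
theorem IsWeakSolution.hasDerivWithinAt {c : ℝ} {f : ℝ → ℝ} {v : H1L}
    (hf : IntegrableOn f (Ioo (0 : ℝ) 1)) (h : IsWeakSolution c f v) {s : ℝ}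
    (hs : s ∈ Icc (0 : ℝ) 1) :
    HasDerivWithinAt (fun t => c * v t) ((∫ t in (0 : ℝ)..s, f t) - ∫ t in (0 : ℝ)..1, f t)
      (Icc (0 : ℝ) 1) s := by
  have hfi : IntervalIntegrable f volume 0 1 := by
    rwa [intervalIntegrable_iff_integrableOn_Ioo_of_le zero_le_one]
  have hFc : ContinuousOn (fun s => ∫ t in (0 : ℝ)..s, f t) (Icc 0 1) := by
    have := (hfi.absolutelyContinuousOnInterval_intervalIntegral (c := 0) (by simp)).continuousOn
    rwa [uIcc_of_le zero_le_one] at this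
  set A := ∫ t in (0 : ℝ)..1, f t with hA
  let q : C(Icc (0 : ℝ) 1, ℝ) :=
    ⟨fun s => (∫ t in (0 : ℝ)..s, f t) - A, (hFc.sub continuousOn_const).domRestrict⟩
  have hq : ∀ s ∈ Icc (0 : ℝ) 1, ext01 q s = (∫ t in (0 : ℝ)..s, f t) - A := by
    intro s hs
    change (∫ t in (0 : ℝ)..(projIcc 0 1 zero_le_one s : ℝ), f t) - A = _
    rw [projIcc_of_mem zero_le_one hs]
  -- the equation says that `c v' - q` is orthogonal to `w'` for every `w`, hence to all of `L²(I)`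
  have horth : ∀ w : H1L, inner ℝ (c • v.D - extL2 q) w.D = 0 := by
    intro w
    rw [inner_sub_left, real_inner_smul_left, inner_extL2_left, ← H1L.integral_D_mul_D]
    have e1 : ∫ s in Ioo (0 : ℝ) 1, ext01 q s * w.D s = -∫ s in Ioo (0 : ℝ) 1, f s * w s := by
      have e2 : ∫ s in Ioo (0 : ℝ) 1, ext01 q s * w.D s
          = ∫ s in (0 : ℝ)..1, ((∫ t in (0 : ℝ)..s, f t) * w.D s - A * w.D s) := by
        rw [intervalIntegral.integral_of_le zero_le_one, integral_Ioc_eq_integral_Ioo]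
        refine setIntegral_congr_fun measurableSet_Ioo fun s hs => ?_
        simp only [hq s (Ioo_subset_Icc_self hs)]
        ring
      have e3 : ∫ s in Ioo (0 : ℝ) 1, f s * w s
          = ∫ s in (0 : ℝ)..1, f s * ∫ t in (0 : ℝ)..s, w.D t := by
        rw [intervalIntegral.integral_of_le zero_le_one, integral_Ioc_eq_integral_Ioo]
        refine setIntegral_congr_fun measurableSet_Ioo fun s hs => ?_
        simp only [w.apply_eq_integral (Ioo_subset_Icc_self hs)]
      rw [e2, e3, intervalIntegral.integral_sub, integral_primitive_mul hfi w.D.intervalIntegrable,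
        intervalIntegral.integral_const_mul]
      · ring
      · refine w.D.intervalIntegrable.continuousOn_mul ?_
        rwa [uIcc_of_le zero_le_one]
      · exact w.D.intervalIntegrable.const_mul A
    have := h w
    rw [e1]
    linarith
  obtain ⟨w, hw⟩ := H1L.D_surjective (c • v.D - extL2 q)
  have hzero : c • v.D = extL2 q := by
    have := horth w
    rw [hw, inner_self_eq_zero] at this
    exact sub_eq_zero.1 this
  have hprim : ∀ t ∈ Icc (0 : ℝ) 1, c * v t = ∫ r in (0 : ℝ)..t, ext01 q r := by
    intro t ht
    rw [v.apply_eq_integral ht, ← intervalIntegral.integral_const_mul,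
      intervalIntegral.integral_of_le ht.1, intervalIntegral.integral_of_le ht.1,
      integral_Ioc_eq_integral_Ioo, integral_Ioc_eq_integral_Ioo]
    apply integral_congr_ae
    have hsub : Ioo 0 t ⊆ Ioo (0 : ℝ) 1 := Ioo_subset_Ioo_right ht.2
    filter_upwards [ae_restrict_of_ae_restrict_of_subset hsub (Lp.coeFn_smul c v.D),
      ae_restrict_of_ae_restrict_of_subset hsub (coeFn_extL2 q)] with r h1 h2
    rw [← h2, ← hzero, h1]
    rfl
  rw [← hq s hs]
  have hder : HasDerivAt (fun t => ∫ r in (0 : ℝ)..t, ext01 q r) (ext01 q s) s :=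
    intervalIntegral.integral_hasDerivAt_right ((continuous_ext01 q).intervalIntegrable _ _)
      (continuous_ext01 q).aestronglyMeasurable.stronglyMeasurableAtFilter
      (continuous_ext01 q).continuousAt
  exact hder.hasDerivWithinAt.congr hprim (hprim s hs)

theorem IsWeakSolution.solvesBVP {c : ℝ} {f : ℝ → ℝ} {v : H1L}
    (hf : IntegrableOn f (Ioo (0 : ℝ) 1)) (h : IsWeakSolution c f v) : SolvesBVP c f v := by
  refine ⟨h, fun s => (∫ t in (0 : ℝ)..s, f t) - ∫ t in (0 : ℝ)..1, f t, ?_,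
    fun s hs => h.hasDerivWithinAt hf hs, ?_, sub_self _⟩
  all_goals
    have hfi : IntervalIntegrable f volume 0 1 := by
      rwa [intervalIntegrable_iff_integrableOn_Ioo_of_le zero_le_one]
    have hFc : ContinuousOn (fun s => ∫ t in (0 : ℝ)..s, f t) (Icc 0 1) := by
      have := (hfi.absolutelyContinuousOnInterval_intervalIntegral (c := 0) (by simp)).continuousOn
      rwa [uIcc_of_le zero_le_one] at this
  · exact hFc.sub continuousOn_const
  · have := (hasWeakDeriv_primitive hf).sub (hFc.integrableOn_Icc.mono_set Ioo_subset_Icc_self)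
      (integrableOn_const (by simp)) hf integrableOn_zero
      (hasWeakDeriv_const (∫ t in (0 : ℝ)..1, f t))
    simpa only [sub_zero] using this

/-! ### The Poincaré inequality -/

/-- The Poincaré inequality with any constant `a < π / 2`. The function `φ(s) = a tan(a(1 - s))`
solves the Riccati equation `φ' + φ² + a² = 0`, `φ(1) = 0`, whence
`(v')² - a² v² = (v' - φ v)² + (φ v²)'`. -/
theorem H1L.sq_mul_integral_sq_le (v : H1L) {a : ℝ} (ha0 : 0 < a) (ha : a < Real.pi / 2) :
    a ^ 2 * ∫ s in Ioo (0 : ℝ) 1, v s ^ 2 ≤ ‖v‖ ^ 2 := by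
  set φ : ℝ → ℝ := fun s => a * Real.tan (a * (1 - s)) with hφ
  have hcos : ∀ s ∈ Icc (0 : ℝ) 1, Real.cos (a * (1 - s)) ≠ 0 := by
    intro s hs
    refine (Real.cos_pos_of_mem_Ioo ⟨?_, ?_⟩).ne'
    · nlinarith [hs.1, hs.2, Real.pi_pos]
    · nlinarith [hs.1, hs.2]
  have hφd : ∀ s ∈ Icc (0 : ℝ) 1, HasDerivAt φ (-(a ^ 2 + φ s ^ 2)) s := by
    intro s hs
    have h1 := Real.hasDerivAt_tan (hcos s hs)
    have h2 : HasDerivAt (fun s : ℝ => a * (1 - s)) (a * (0 - 1)) s :=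
      ((hasDerivAt_const s (1 : ℝ)).sub (hasDerivAt_id s)).const_mul a
    have h3 := (h1.comp s h2).const_mul a
    refine h3.congr_deriv ?_
    have h4 := Real.cos_sq_add_sin_sq (a * (1 - s))
    have h5 := hcos s hs
    simp only [hφ, Real.tan_eq_sin_div_cos]
    field_simp
    linear_combination h4
  have hφC : ContDiffOn ℝ 1 φ (uIcc 0 1) := by
    rw [uIcc_of_le zero_le_one]
    intro s hs
    refine (contDiffAt_const.mul ?_).contDiffWithinAt
    exact ContDiffAt.comp (g := Real.tan) (f := fun s => a * (1 - s)) s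
      (Real.contDiffAt_tan.2 (hcos s hs))
      (contDiffAt_const.mul (contDiffAt_const.sub contDiffAt_id))
  have hv := v.D.intervalIntegrable
  have hP := hv.absolutelyContinuousOnInterval_intervalIntegral (c := 0) (by simp)
  have hΦ := hφC.absolutelyContinuousOnInterval.fun_mul (hP.fun_mul hP)
  have hΦ1 := hΦ.integral_deriv_eq_sub
  have hφ1 : φ 1 = 0 := by simp [hφ]
  rw [hφ1, intervalIntegral.integral_same] at hΦ1
  have hΦi := hΦ.intervalIntegrable_deriv
  rw [intervalIntegrable_iff_integrableOn_Ioo_of_le zero_le_one] at hΦi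
  rw [intervalIntegral.integral_of_le zero_le_one, integral_Ioc_eq_integral_Ioo] at hΦ1
  have hae : ∀ᵐ s ∂volume.restrict (Ioo (0 : ℝ) 1),
      deriv (fun s => φ s * ((∫ t in (0 : ℝ)..s, v.D t) * ∫ t in (0 : ℝ)..s, v.D t)) s
        + (v.D s - φ s * v s) ^ 2 = v.D s * v.D s - a ^ 2 * v s ^ 2 := by
    rw [ae_restrict_iff' measurableSet_Ioo]
    filter_upwards [hv.ae_hasDerivAt_integral] with s hs hsI
    have hsI' := Ioo_subset_Icc_self hsI
    have h1 := hs (by rwa [uIcc_of_le zero_le_one]) 0 (by simp)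
    have h2 := ((hφd s hsI').mul (h1.mul h1)).deriv
    have h3 := v.apply_eq_integral hsI'
    rw [← h3] at h2
    refine (congrArg (· + _) h2).trans ?_
    simp only [Pi.mul_apply, ← h3]
    ring
  have hD2 : IntegrableOn (fun s => v.D s * v.D s) (Ioo (0 : ℝ) 1) := by
    have := (Lp.memLp v.D).integrable_sq
    simp only [sq] at this
    exact this
  have hv2 : IntegrableOn (fun s => v s ^ 2) (Ioo (0 : ℝ) 1) :=
    integrableOn_of_continuous (v.continuous.pow 2)
  have hR := hD2.sub (hv2.const_mul (a ^ 2))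
  have hsq : IntegrableOn (fun s => (v.D s - φ s * v s) ^ 2) (Ioo (0 : ℝ) 1) := by
    refine (hR.sub hΦi).congr ?_
    filter_upwards [hae] with s hs
    simp only [Pi.sub_apply]
    linarith
  have htot := integral_congr_ae hae
  rw [integral_add hΦi hsq, hΦ1, integral_sub hD2 (hv2.const_mul _), integral_const_mul,
    H1L.integral_D_mul_D, real_inner_self_eq_norm_sq, ← H1L.norm_eq] at htot
  have hnn : 0 ≤ ∫ s in Ioo (0 : ℝ) 1, (v.D s - φ s * v s) ^ 2 :=
    integral_nonneg fun s => sq_nonneg _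
  linarith

/-! ### Superposition operators on `C([0,1])` -/

/-- First-order Taylor expansion with quadratic remainder. -/
theorem abs_taylor_le {g g' : ℝ → ℝ} (hg : ∀ x, HasDerivAt g (g' x) x)
    (hL : ∀ x y, |g' y - g' x| ≤ |y - x|) (x y : ℝ) :
    |g y - g x - g' x * (y - x)| ≤ |y - x| ^ 2 := by
  have h := Convex.norm_image_sub_le_of_norm_hasDerivWithin_le
    (f := fun t => g t - g' x * t) (f' := fun t => g' t - g' x) (s := uIcc x y) (x := x) (y := y)
    (C := |y - x|)
    (fun t _ => by
      exact (((hg t).sub ((hasDerivAt_id t).const_mul (g' x))).congr_deriv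
        (by rw [mul_one])).hasDerivWithinAt)
    (fun t ht => (hL x t).trans (abs_sub_left_of_mem_uIcc ht)) (convex_uIcc x y)
    left_mem_uIcc right_mem_uIcc
  simp only [Real.norm_eq_abs] at h
  rw [sq]
  refine le_of_eq_of_le ?_ h
  congr 1
  ring

variable {K : Type*} [TopologicalSpace K] [CompactSpace K]

/-- The superposition operator `f ↦ g ∘ f` on `C(K)` is differentiable with derivative
`k ↦ (g' ∘ f) k` if `g'` is Lipschitz continuous. -/
theorem hasFDerivAt_comp_left {g g' : C(ℝ, ℝ)} (hg : ∀ x, HasDerivAt g (g' x) x)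
    (hL : ∀ x y, |g' y - g' x| ≤ |y - x|) (f : C(K, ℝ)) :
    HasFDerivAt (fun f : C(K, ℝ) => g.comp f) (ContinuousLinearMap.mul ℝ C(K, ℝ) (g'.comp f)) f := by
  rw [hasFDerivAt_iff_isLittleO_nhds_zero]
  refine Asymptotics.IsBigO.trans_isLittleO ?_
    (Asymptotics.isLittleO_norm_pow_id (E' := C(K, ℝ)) one_lt_two)
  refine Asymptotics.IsBigO.of_bound 1 (Filter.Eventually.of_forall fun k => ?_)
  rw [one_mul, norm_pow, norm_norm]
  refine (ContinuousMap.norm_le _ (by positivity)).2 fun s => ?_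
  have h := abs_taylor_le hg hL (f s) (f s + k s)
  rw [add_sub_cancel_left] at h
  refine h.trans ?_
  gcongr
  exact k.norm_coe_le_norm s

/-- The sine as an element of `C(ℝ)`. -/
abbrev sinC : C(ℝ, ℝ) := ⟨Real.sin, Real.continuous_sin⟩

/-- The cosine as an element of `C(ℝ)`. -/
abbrev cosC : C(ℝ, ℝ) := ⟨Real.cos, Real.continuous_cos⟩

theorem abs_sin_sub_sin_le (x y : ℝ) : |Real.sin y - Real.sin x| ≤ |y - x| := by
  simpa using Convex.norm_image_sub_le_of_norm_hasDerivWithin_le (C := 1)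
    (fun t _ => (Real.hasDerivAt_sin t).hasDerivWithinAt) (fun t _ => Real.abs_cos_le_one t)
    convex_univ (mem_univ x) (mem_univ y)

theorem abs_cos_sub_cos_le (x y : ℝ) : |Real.cos y - Real.cos x| ≤ |y - x| := by
  simpa using Convex.norm_image_sub_le_of_norm_hasDerivWithin_le (C := 1)
    (fun t _ => (Real.hasDerivAt_cos t).hasDerivWithinAt)
    (fun t _ => by rw [norm_neg]; exact Real.abs_sin_le_one t)
    convex_univ (mem_univ x) (mem_univ y)

theorem hasFDerivAt_sinC_comp (f : C(K, ℝ)) :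
    HasFDerivAt (fun f : C(K, ℝ) => sinC.comp f)
      (ContinuousLinearMap.mul ℝ C(K, ℝ) (cosC.comp f)) f :=
  hasFDerivAt_comp_left (fun x => Real.hasDerivAt_sin x) abs_cos_sub_cos_le f

theorem hasFDerivAt_cosC_comp (f : C(K, ℝ)) :
    HasFDerivAt (fun f : C(K, ℝ) => cosC.comp f)
      (ContinuousLinearMap.mul ℝ C(K, ℝ) ((-sinC).comp f)) f :=
  hasFDerivAt_comp_left (fun x => Real.hasDerivAt_cos x)
    (fun x y => by
      change |-Real.sin y - -Real.sin x| ≤ _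
      rw [neg_sub_neg, abs_sub_comm]
      exact abs_sin_sub_sin_le x y) f

theorem contDiff_sinC_comp : ContDiff ℝ 1 fun f : C(K, ℝ) => sinC.comp f :=
  contDiff_one_iff_hasFDerivAt.2 ⟨_, (ContinuousLinearMap.mul ℝ C(K, ℝ)).continuous.comp
    (ContinuousMap.continuous_postcomp cosC), hasFDerivAt_sinC_comp⟩

theorem contDiff_cosC_comp : ContDiff ℝ 1 fun f : C(K, ℝ) => cosC.comp f :=
  contDiff_one_iff_hasFDerivAt.2 ⟨_, (ContinuousLinearMap.mul ℝ C(K, ℝ)).continuous.comp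
    (ContinuousMap.continuous_postcomp (-sinC)), hasFDerivAt_cosC_comp⟩

/-- The function `h · Dm(f)` in `C([0,1])`. -/
def torque (h : R2) (f : C(Icc (0 : ℝ) 1, ℝ)) : C(Icc (0 : ℝ) 1, ℝ) :=
  h 1 • cosC.comp f - h 0 • sinC.comp f

/-- The function `h · D²m(f)` in `C([0,1])`. -/
def stiffness (h : R2) (f : C(Icc (0 : ℝ) 1, ℝ)) : C(Icc (0 : ℝ) 1, ℝ) :=
  -(h 0 • cosC.comp f + h 1 • sinC.comp f)

theorem inner_Dm (h : R2) (x : ℝ) :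
    inner ℝ h (Dm x) = h 1 * Real.cos x - h 0 * Real.sin x := by
  simp [Dm, PiLp.inner_apply, Fin.sum_univ_two]
  ring

theorem inner_D2m (h : R2) (x : ℝ) :
    inner ℝ h (D2m x) = -(h 0 * Real.cos x + h 1 * Real.sin x) := by
  simp [D2m, PiLp.inner_apply, Fin.sum_univ_two]
  ring

theorem ext01_torque (h : R2) (α ϑ : H1L) (s : ℝ) :
    ext01 (torque h (H1L.toC α + H1L.toC ϑ)) s = inner ℝ h (Dm (α s + ϑ s)) :=
  (inner_Dm h _).symm

theorem ext01_stiffness (h : R2) (α ϑ : H1L) (s : ℝ) :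
    ext01 (stiffness h (H1L.toC α + H1L.toC ϑ)) s = linCoeff h α ϑ s :=
  (inner_D2m h _).symm

/-! ### The constraint map and its differential -/

section Dual

variable {V : Type*} [NormedAddCommGroup V] [InnerProductSpace ℝ V]

variable (V) in
/-- The scalar product of a real Hilbert space as a map into the dual that is linear over `ℝ`,
rather than conjugate-linear. -/
def innerForm : V →L[ℝ] StrongDual ℝ V :=
  (isBoundedBilinearMap_inner (𝕜 := ℝ) (E := V)).toContinuousLinearMap

theorem innerForm_apply (x y : V) : innerForm V x y = inner ℝ x y := rfl

theorem exists_innerForm_eq [CompleteSpace V] (L : StrongDual ℝ V) : ∃ x, innerForm V x = L := by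
  refine ⟨(InnerProductSpace.toDual ℝ V).symm L, ?_⟩
  ext y
  rw [innerForm_apply, InnerProductSpace.toDual_symm_apply]

variable {n : ℕ}

variable (V) in
/-- A functional on `V`, regarded as a functional of the `i`-th component. -/
def liftDual (i : Fin n) : StrongDual ℝ V →L[ℝ] StrongDual ℝ (Fin n → V) :=
  (ContinuousLinearMap.compL ℝ (Fin n → V) V ℝ).flip (ContinuousLinearMap.proj i)

theorem liftDual_apply (i : Fin n) (L : StrongDual ℝ V) (u : Fin n → V) :
    liftDual V i L u = L (u i) := rfl

theorem exists_eq_sum_liftDual [CompleteSpace V] (L : StrongDual ℝ (Fin n → V)) :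
    ∃ g : Fin n → V, L = ∑ i, liftDual V i (innerForm V (g i)) := by
  choose g hg using fun i : Fin n =>
    exists_innerForm_eq (L.comp (ContinuousLinearMap.single ℝ (fun _ => V) i))
  refine ⟨g, ?_⟩
  ext u
  rw [sum_apply]
  simp only [liftDual_apply, hg, ContinuousLinearMap.comp_apply,
    ContinuousLinearMap.single_apply]
  rw [← map_sum, Finset.univ_sum_single]

end Dual

/-- The functional `w ↦ ∫ f w` on `H¹_{0L}(I)`, for `f ∈ C([0,1])`. -/
def loadForm : C(Icc (0 : ℝ) 1, ℝ) →L[ℝ] StrongDual ℝ H1L :=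
  ((ContinuousLinearMap.compL ℝ H1L L2I ℝ).flip H1L.toL2).comp ((innerForm L2I).comp extL2)

theorem loadForm_apply (f : C(Icc (0 : ℝ) 1, ℝ)) (w : H1L) :
    loadForm f w = ∫ s in Ioo (0 : ℝ) 1, ext01 f s * w s :=
  H1L.inner_extL2_toL2 f w

theorem contDiff_torque :
    ContDiff ℝ 1 fun p : R2 × C(Icc (0 : ℝ) 1, ℝ) => torque p.1 p.2 := by
  have h (j : Fin 2) : ContDiff ℝ 1 fun p : R2 × C(Icc (0 : ℝ) 1, ℝ) => p.1 j :=
    (EuclideanSpace.proj (𝕜 := ℝ) j).contDiff.comp contDiff_fst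
  exact ((h 1).smul (contDiff_cosC_comp.comp contDiff_snd)).sub
    ((h 0).smul (contDiff_sinC_comp.comp contDiff_snd))

theorem hasDerivAt_torque (h k : R2) (f g : C(Icc (0 : ℝ) 1, ℝ)) :
    HasDerivAt (fun t : ℝ => torque (h + t • k) (f + t • g))
      (torque k f + stiffness h f * g) 0 := by
  have hl (j : Fin 2) : HasDerivAt (fun t : ℝ => (h + t • k) j) (k j) 0 := by
    have := ((hasDerivAt_id (0 : ℝ)).mul_const (k j)).const_add (h j)
    rwa [one_mul] at this
  have hf : HasDerivAt (fun t : ℝ => f + t • g) g 0 := by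
    have := ((hasDerivAt_id (0 : ℝ)).smul_const g).const_add f
    rwa [one_smul] at this
  have hc := (hasFDerivAt_cosC_comp (f + (0 : ℝ) • g)).comp_hasDerivAt (0 : ℝ) hf
  have hs := (hasFDerivAt_sinC_comp (f + (0 : ℝ) • g)).comp_hasDerivAt (0 : ℝ) hf
  refine (((hl 1).smul hc).sub ((hl 0).smul hs)).congr_deriv ?_
  ext s
  simp [torque, stiffness]
  ring

variable {n : ℕ}

theorem constraintMap_apply (p : Config n) (u : Fin n → H1L) :
    constraintMap p u = ∑ i, ((∫ s in Ioo (0 : ℝ) 1, (p.2.2 i).D s * (u i).D s)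
      - ∫ s in Ioo (0 : ℝ) 1, inner ℝ (p.1 i) (Dm (p.2.1 s + p.2.2 i s)) * u i s) := rfl

theorem constraintMap_eq_sum (p : Config n) :
    constraintMap p = ∑ i, liftDual H1L i (innerForm H1L (p.2.2 i)
      - loadForm (torque (p.1 i) (H1L.toC p.2.1 + H1L.toC (p.2.2 i)))) := by
  ext u
  rw [constraintMap_apply, sum_apply]
  refine Finset.sum_congr rfl fun i _ => ?_
  rw [liftDual_apply, sub_apply, innerForm_apply, loadForm_apply, H1L.inner_eq_integral]
  simp only [ext01_torque]

theorem contDiff_constraintMap : ContDiff ℝ 1 (constraintMap (n := n)) := by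
  rw [funext constraintMap_eq_sum]
  refine ContDiff.sum fun i _ => ?_
  have h1 : ContDiff ℝ 1 fun p : Config n => p.2.2 i :=
    (contDiff_apply ℝ H1L i).comp (contDiff_snd.comp contDiff_snd)
  have h2 : ContDiff ℝ 1 fun p : Config n => H1L.toC p.2.1 + H1L.toC (p.2.2 i) :=
    (H1L.toC.contDiff.comp (contDiff_fst.comp contDiff_snd)).add (H1L.toC.contDiff.comp h1)
  have h3 : ContDiff ℝ 1 fun p : Config n => p.1 i := (contDiff_apply ℝ R2 i).comp contDiff_fst
  exact (liftDual H1L i).contDiff.comp (((innerForm H1L).contDiff.comp h1).sub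
    (loadForm.contDiff.comp (contDiff_torque.comp (h3.prodMk h2))))

theorem fderiv_constraintMap (p ψ : Config n) :
    fderiv ℝ constraintMap p ψ = ∑ i, liftDual H1L i (innerForm H1L (ψ.2.2 i)
      - loadForm (torque (ψ.1 i) (H1L.toC p.2.1 + H1L.toC (p.2.2 i))
        + stiffness (p.1 i) (H1L.toC p.2.1 + H1L.toC (p.2.2 i))
          * (H1L.toC ψ.2.1 + H1L.toC (ψ.2.2 i)))) := by
  have hline : HasDerivAt (fun t : ℝ => p + t • ψ) ψ 0 := by
    have := ((hasDerivAt_id (0 : ℝ)).smul_const ψ).const_add p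
    rwa [one_smul] at this
  have h1 : HasFDerivAt constraintMap (fderiv ℝ constraintMap p) (p + (0 : ℝ) • ψ) := by
    rw [zero_smul, add_zero]
    exact (contDiff_constraintMap.differentiable one_ne_zero p).hasFDerivAt
  refine (h1.comp_hasDerivAt (0 : ℝ) hline).unique ?_
  rw [funext constraintMap_eq_sum]
  refine HasDerivAt.fun_sum fun i _ => ?_
  refine (liftDual H1L i).hasFDerivAt.comp_hasDerivAt (0 : ℝ) (HasDerivAt.sub ?_ ?_)
  · refine (innerForm H1L).hasFDerivAt.comp_hasDerivAt (0 : ℝ) ?_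
    have := ((hasDerivAt_id (0 : ℝ)).smul_const (ψ.2.2 i)).const_add (p.2.2 i)
    rwa [one_smul] at this
  · refine loadForm.hasFDerivAt.comp_hasDerivAt (0 : ℝ) ?_
    refine (hasDerivAt_torque (p.1 i) (ψ.1 i) _ _).congr_of_eventuallyEq
      (Filter.Eventually.of_forall fun t => ?_)
    change torque (p.1 i + t • ψ.1 i)
      (H1L.toC (p.2.1 + t • ψ.2.1) + H1L.toC (p.2.2 i + t • ψ.2.2 i)) = _
    simp only [map_add, map_smul, smul_add]
    congr 1
    abel

/-- The differential of the constraint map in the direction `ψ = (k, β, η)`: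
`⟨DG ψ, u⟩ = ∑ {∫ ηᵢ' uᵢ' - ∫ (kᵢ · Dm(α + ϑᵢ) + hᵢ · D²m(α + ϑᵢ) (β + ηᵢ)) uᵢ}`. -/
theorem fderiv_constraintMap_apply (p ψ : Config n) (u : Fin n → H1L) :
    fderiv ℝ constraintMap p ψ u = ∑ i, (inner ℝ (ψ.2.2 i) (u i)
      - ∫ s in Ioo (0 : ℝ) 1, (inner ℝ (ψ.1 i) (Dm (p.2.1 s + p.2.2 i s))
        + linCoeff (p.1 i) p.2.1 (p.2.2 i) s * (ψ.2.1 s + ψ.2.2 i s)) * u i s) := by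
  rw [fderiv_constraintMap, sum_apply]
  refine Finset.sum_congr rfl fun i _ => ?_
  rw [liftDual_apply, sub_apply, innerForm_apply, loadForm_apply]
  simp only [← ext01_torque, ← ext01_stiffness]
  rfl

/-- The admissible set is the zero set of the constraint map. -/
theorem mem_admissible_iff (p : Config n) : p ∈ admissible n ↔ constraintMap p = 0 := by
  have key (i : Fin n) (w : H1L) : 1 * (∫ s in Ioo (0 : ℝ) 1, (p.2.2 i).D s * w.D s)
      + (∫ s in Ioo (0 : ℝ) 1, stateTerm (p.1 i) p.2.1 (p.2.2 i) s * w s)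
      = (∫ s in Ioo (0 : ℝ) 1, (p.2.2 i).D s * w.D s)
        - ∫ s in Ioo (0 : ℝ) 1, inner ℝ (p.1 i) (Dm (p.2.1 s + p.2.2 i s)) * w s := by
    simp only [stateTerm, neg_mul, integral_neg, one_mul, sub_eq_add_neg]
  constructor
  · intro h
    ext u
    rw [constraintMap_apply]
    refine Finset.sum_eq_zero fun i _ => ?_
    rw [← key]
    exact h i (u i)
  · intro h i w
    rw [key]
    have h1 : constraintMap p (Pi.single i w) = 0 := by rw [h]; rfl
    rw [constraintMap_apply, Finset.sum_eq_single i] at h1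
    · simpa only [Pi.single_eq_same] using h1
    · intro j _ hj
      simp only [Pi.single_eq_of_ne hj, H1L.integral_D_mul_D]
      have h0 : (0 : H1L).D = 0 := H1L.DLin.map_zero
      have h2 : ∀ s, (0 : H1L) s = 0 := fun _ => rfl
      simp [h0, h2]
    · simp

/-! ### Regular points -/

/-- The Fredholm alternative for the linearized state equation: if `-u'' - r u = 0`,
`u(0) = u'(1) = 0` has no nonzero weak solution, the equation with an arbitrary right-hand side
in the dual of `H¹_{0L}(I)` is solvable. -/
theorem exists_sub_loadForm_eq (r : C(Icc (0 : ℝ) 1, ℝ))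
    (h : ∀ u : H1L, (∀ w, inner ℝ u w = loadForm (r * H1L.toC u) w) → u = 0)
    (L : StrongDual ℝ H1L) :
    ∃ u, innerForm H1L u - loadForm (r * H1L.toC u) = L := by
  obtain ⟨g, rfl⟩ := exists_innerForm_eq L
  let A : C(Icc (0 : ℝ) 1, ℝ) →L[ℝ] H1L :=
    (ContinuousLinearMap.adjoint H1L.toL2).comp
      (extL2.comp (ContinuousLinearMap.mul ℝ C(Icc (0 : ℝ) 1, ℝ) r))
  let K : H1L →L[ℝ] H1L := A.comp H1L.toC
  have hK : ∀ u w, inner ℝ (K u) w = loadForm (r * H1L.toC u) w := by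
    intro u w
    exact ContinuousLinearMap.adjoint_inner_left H1L.toL2 w (extL2 (r * H1L.toC u))
  have hcomp : IsCompactOperator K := H1L.isCompactOperator_toC.clm_comp A
  rcases IsCompactOperator.hasEigenvalue_or_mem_resolventSet hcomp one_ne_zero with he | he
  · obtain ⟨u, hu⟩ := he.exists_hasEigenvector
    have hu1 : K u = u := by
      have := hu.apply_eq_smul
      rwa [one_smul] at this
    refine absurd (h u fun w => ?_) hu.2
    rw [← hK, hu1]
  · rw [spectrum.mem_resolventSet_iff, map_one] at he
    obtain ⟨B, hB⟩ := he
    refine ⟨(↑B⁻¹ : H1L →L[ℝ] H1L) g, ?_⟩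
    have h1 : (1 - K) ((↑B⁻¹ : H1L →L[ℝ] H1L) g) = g := by
      rw [← hB, ← mul_apply_eq_comp, B.mul_inv]
      rfl
    ext w
    rw [sub_apply, innerForm_apply, innerForm_apply, ← hK, ← inner_sub_left]
    exact congrArg (fun x => inner ℝ x w) h1

theorem loadForm_stiffness_mul (h : R2) (α ϑ u w : H1L) :
    loadForm (stiffness h (H1L.toC α + H1L.toC ϑ) * H1L.toC u) w
      = ∫ s in Ioo (0 : ℝ) 1, linCoeff h α ϑ s * u s * w s := by
  rw [loadForm_apply]
  simp only [← ext01_stiffness]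
  rfl

/-- If no linearized state equation has a nonzero solution, already the variations of `ϑ` make
the differential of the constraint map surjective. -/
theorem isRegularPoint_of_forall_eq_zero (p : Config n)
    (h : ∀ i, ∀ u : H1L, (∀ w : H1L, inner ℝ u w
      = ∫ s in Ioo (0 : ℝ) 1, linCoeff (p.1 i) p.2.1 (p.2.2 i) s * u s * w s) → u = 0) :
    IsRegularPoint p := by
  refine ⟨contDiff_constraintMap.differentiable one_ne_zero p, fun L => ?_⟩
  obtain ⟨g, rfl⟩ := exists_eq_sum_liftDual L
  choose η hη using fun i =>
    exists_sub_loadForm_eq (stiffness (p.1 i) (H1L.toC p.2.1 + H1L.toC (p.2.2 i)))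
      (fun u hu => h i u fun w => (hu w).trans (loadForm_stiffness_mul _ _ _ _ _))
      (innerForm H1L (g i))
  refine ⟨(0, 0, η), ?_⟩
  rw [fderiv_constraintMap]
  refine Finset.sum_congr rfl fun i _ => ?_
  rw [← hη i]
  have h0 : ∀ f, torque ((0 : Fin n → R2) i) f = 0 := by
    intro f
    ext s
    simp [torque]
  simp only [h0, map_zero, zero_add]

/-- The eigenvalue problem with `μ = 1` is the homogeneous linearized state equation. -/
theorem isSLEigenvalue_one_iff (r : ℝ → ℝ) :
    IsSLEigenvalue (fun s => max (-r s) 0 + 1) (fun s => max (r s) 0 + 1) 1 ↔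
      ∃ u : H1L, u ≠ 0 ∧ ∀ w : H1L, inner ℝ u w = ∫ s in Ioo (0 : ℝ) 1, r s * u s * w s := by
  refine exists_congr fun u => and_congr_right fun _ => forall_congr' fun w => ?_
  have e : ∀ s, ((max (-r s) 0 + 1) * u s - 1 * ((max (r s) 0 + 1) * u s)) * w s
      = -(r s * u s * w s) := by
    intro s
    linear_combination -(u s * w s) * max_zero_sub_max_neg_zero_eq_self (r s)
  simp only [e, integral_neg, H1L.inner_eq_integral]
  rw [one_mul]
  constructor <;> intro h <;> linarith

theorem abs_linCoeff_le (h : R2) (α ϑ : H1L) (s : ℝ) : |linCoeff h α ϑ s| ≤ ‖h‖ := by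
  refine (abs_real_inner_le_norm _ _).trans ?_
  have : ‖D2m (α s + ϑ s)‖ = 1 := by simp [D2m, EuclideanSpace.norm_eq]
  rw [this, mul_one]

theorem continuous_linCoeff (h : R2) (α ϑ : H1L) : Continuous (linCoeff h α ϑ) :=
  (continuous_ext01 (stiffness h (H1L.toC α + H1L.toC ϑ))).congr (ext01_stiffness h α ϑ)

/-- By the Poincaré inequality, the linearized state equation has no nonzero solution if the
magnetic field is small. -/
theorem eq_zero_of_norm_lt {h : R2} (hh : ‖h‖ < (cP ^ 2)⁻¹) {α ϑ u : H1L}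
    (hu : ∀ w : H1L, inner ℝ u w = ∫ s in Ioo (0 : ℝ) 1, linCoeff h α ϑ s * u s * w s) :
    u = 0 := by
  have hc : (cP ^ 2)⁻¹ = (Real.pi / 2) ^ 2 := by rw [cP, ← inv_pow, inv_div]
  rw [hc] at hh
  have hpi := Real.pi_pos
  -- a Poincaré constant `a < π / 2` that still beats the field
  obtain ⟨a, ha1, ha2⟩ := exists_between ((Real.sqrt_lt' (by positivity)).2 hh)
  have ha0 : 0 < a := (Real.sqrt_nonneg _).trans_lt ha1
  have hha : ‖h‖ < a ^ 2 := (Real.sqrt_lt' ha0).1 ha1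
  have hP := u.sq_mul_integral_sq_le ha0 ha2
  have hi : IntegrableOn (fun s => u s ^ 2) (Ioo (0 : ℝ) 1) :=
    integrableOn_of_continuous (u.continuous.pow 2)
  have hle : ‖u‖ ^ 2 ≤ ‖h‖ * ∫ s in Ioo (0 : ℝ) 1, u s ^ 2 := by
    rw [← real_inner_self_eq_norm_sq, hu, ← integral_const_mul]
    refine integral_mono ?_ (hi.const_mul _) fun s => ?_
    · exact integrableOn_of_continuous
        (((continuous_linCoeff h α ϑ).mul u.continuous).mul u.continuous)
    · have := mul_le_mul_of_nonneg_right ((le_abs_self _).trans (abs_linCoeff_le h α ϑ s))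
        (sq_nonneg (u s))
      change linCoeff h α ϑ s * u s * u s ≤ ‖h‖ * u s ^ 2
      linarith
  have hnn : 0 ≤ ∫ s in Ioo (0 : ℝ) 1, u s ^ 2 := integral_nonneg fun s => sq_nonneg _
  have hz : ∫ s in Ioo (0 : ℝ) 1, u s ^ 2 = 0 := by nlinarith
  rw [hz, mul_zero] at hle
  exact norm_eq_zero.1 (pow_eq_zero_iff two_ne_zero |>.1 (le_antisymm hle (sq_nonneg _)))

/-! ### Lagrange multipliers -/

section Multiplier

variable {V E : Type*} [NormedAddCommGroup V] [InnerProductSpace ℝ V] [CompleteSpace V]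
  [NormedAddCommGroup E] [NormedSpace ℝ E] [CompleteSpace E]

/-- Powers of a Hilbert space are reflexive. -/
theorem exists_eq_apply_of_bidual (Λ : StrongDual ℝ (StrongDual ℝ (Fin n → V))) :
    ∃ lam : Fin n → V, ∀ L, Λ L = L lam := by
  choose lam hlam using fun i => exists_innerForm_eq (Λ.comp ((liftDual V i).comp (innerForm V)))
  refine ⟨lam, fun L => ?_⟩
  obtain ⟨g, rfl⟩ := exists_eq_sum_liftDual L
  rw [map_sum, sum_apply]
  refine Finset.sum_congr rfl fun i _ => ?_
  have h := congrArg (fun M => M (g i)) (hlam i)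
  simp only [innerForm_apply, ContinuousLinearMap.comp_apply] at h
  rw [← h, liftDual_apply, innerForm_apply, real_inner_comm]

/-- The Lagrange multiplier rule at a regular point of a constraint with values in the dual of a
power of a Hilbert space. -/
theorem exists_lagrangeMultiplier {G : E → StrongDual ℝ (Fin n → V)} {φ : E → ℝ} {x : E}
    {G' : E →L[ℝ] StrongDual ℝ (Fin n → V)} {φ' : StrongDual ℝ E}
    (hG : HasStrictFDerivAt G G' x) (hφ : HasStrictFDerivAt φ φ' x)
    (hsurj : Function.Surjective G') (hmin : IsLocalExtrOn φ {y | G y = G x} x) :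
    ∃ lam : Fin n → V, ∀ ψ, φ' ψ = G' ψ lam := by
  obtain ⟨Λ, Λ₀, hne, hΛ⟩ := hmin.exists_linear_map_of_hasStrictFDerivAt hG hφ
  -- `Λ` is only an algebraic functional; it is continuous because `G'` is a quotient map
  have hcont : Continuous Λ := by
    refine (G'.isQuotientMap hsurj).continuous_iff.2 ?_
    have e : (Λ ∘ G' : E → ℝ) = fun ψ => -(Λ₀ • φ' ψ) :=
      funext fun ψ => eq_neg_of_add_eq_zero_left (hΛ ψ)
    rw [e]
    exact (φ'.continuous.const_smul Λ₀).neg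
  have h0 : Λ₀ ≠ 0 := by
    rintro rfl
    refine hne (Prod.ext (LinearMap.ext fun L => ?_) rfl)
    obtain ⟨ψ, rfl⟩ := hsurj L
    simpa using hΛ ψ
  obtain ⟨lam, hlam⟩ := exists_eq_apply_of_bidual (⟨Λ, hcont⟩ : StrongDual ℝ _)
  refine ⟨-(Λ₀⁻¹ • lam), fun ψ => ?_⟩
  have h1 : Λ (G' ψ) = G' ψ lam := hlam (G' ψ)
  have h2 := hΛ ψ
  rw [h1, smul_eq_mul] at h2
  rw [map_neg, map_smul, smul_eq_mul]
  field_simp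
  linarith

end Multiplier

/-! ### The differential of the cost -/

theorem cost_eq (ε γ : ℝ) (ϑbar : Fin n → L2I) (p : Config n) :
    cost ε γ ϑbar p = 1 / 2 * ∑ i, ‖H1L.toL2 (p.2.2 i) - ϑbar i‖ ^ 2
      + ε / 2 * ‖p.2.1‖ ^ 2 + γ / 2 * ∑ i, ‖p.1 i‖ ^ 2 := by
  unfold cost
  congr 3
  · refine Finset.sum_congr rfl fun i _ => ?_
    rw [← real_inner_self_eq_norm_sq, inner_L2I]
    apply integral_congr_ae
    filter_upwards [Lp.coeFn_sub (H1L.toL2 (p.2.2 i)) (ϑbar i), H1L.coeFn_toL2 (p.2.2 i)]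
      with s h1 h2
    rw [h1, Pi.sub_apply, h2, sq]
  · rw [H1L.norm_eq, ← real_inner_self_eq_norm_sq, inner_L2I]
    simp only [sq]

theorem contDiff_cost (ε γ : ℝ) (ϑbar : Fin n → L2I) : ContDiff ℝ 1 (cost ε γ ϑbar) := by
  rw [funext (cost_eq ε γ ϑbar)]
  have h1 (i : Fin n) : ContDiff ℝ 1 fun p : Config n => p.2.2 i :=
    (contDiff_apply ℝ H1L i).comp (contDiff_snd.comp contDiff_snd)
  have h2 : ContDiff ℝ 1 fun p : Config n => p.2.1 := contDiff_fst.comp contDiff_snd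
  have h3 (i : Fin n) : ContDiff ℝ 1 fun p : Config n => p.1 i :=
    (contDiff_apply ℝ R2 i).comp contDiff_fst
  refine ((contDiff_const.mul (ContDiff.sum fun i _ => ?_)).add
    (contDiff_const.mul (h2.norm_sq ℝ))).add
    (contDiff_const.mul (ContDiff.sum fun i _ => (h3 i).norm_sq ℝ))
  exact ((H1L.toL2.contDiff.comp (h1 i)).sub contDiff_const).norm_sq ℝ

/-- The differential of the cost in the direction `ψ = (k, β, η)`:
`∑ ∫ (ϑᵢ - ϑ̄ᵢ) ηᵢ + ε ∫ α' β' + γ ∑ hᵢ · kᵢ`. -/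
theorem fderiv_cost (ε γ : ℝ) (ϑbar : Fin n → L2I) (p ψ : Config n) :
    fderiv ℝ (cost ε γ ϑbar) p ψ
      = ∑ i, inner ℝ (H1L.toL2 (p.2.2 i) - ϑbar i) (H1L.toL2 (ψ.2.2 i))
        + ε * inner ℝ p.2.1 ψ.2.1 + γ * ∑ i, inner ℝ (p.1 i) (ψ.1 i) := by
  have hline {F : Type} [NormedAddCommGroup F] [NormedSpace ℝ F] (x y : F) :
      HasDerivAt (fun t : ℝ => x + t • y) y 0 := by
    have := ((hasDerivAt_id (0 : ℝ)).smul_const y).const_add x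
    rwa [one_smul] at this
  have h1 : HasFDerivAt (cost ε γ ϑbar) (fderiv ℝ (cost ε γ ϑbar) p) (p + (0 : ℝ) • ψ) := by
    rw [zero_smul, add_zero]
    exact ((contDiff_cost ε γ ϑbar).differentiable one_ne_zero p).hasFDerivAt
  refine (h1.comp_hasDerivAt (0 : ℝ) (hline p ψ)).unique ?_
  rw [funext (cost_eq ε γ ϑbar)]
  have e1 : HasDerivAt (fun t : ℝ => ∑ i, ‖H1L.toL2 (p.2.2 i + t • ψ.2.2 i) - ϑbar i‖ ^ 2)
      (∑ i, 2 * inner ℝ (H1L.toL2 (p.2.2 i) - ϑbar i) (H1L.toL2 (ψ.2.2 i))) 0 := by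
    refine HasDerivAt.fun_sum fun i _ => ?_
    have := ((H1L.toL2.hasFDerivAt.comp_hasDerivAt (0 : ℝ)
      (hline (p.2.2 i) (ψ.2.2 i))).sub_const (ϑbar i)).norm_sq
    simpa using this
  have e2 : HasDerivAt (fun t : ℝ => ‖p.2.1 + t • ψ.2.1‖ ^ 2) (2 * inner ℝ p.2.1 ψ.2.1) 0 := by
    simpa using (hline p.2.1 ψ.2.1).norm_sq
  have e3 : HasDerivAt (fun t : ℝ => ∑ i, ‖p.1 i + t • ψ.1 i‖ ^ 2)
      (∑ i, 2 * inner ℝ (p.1 i) (ψ.1 i)) 0 := by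
    refine HasDerivAt.fun_sum fun i _ => ?_
    simpa using (hline (p.1 i) (ψ.1 i)).norm_sq
  refine (((e1.const_mul (1 / 2)).add (e2.const_mul (ε / 2))).add
    (e3.const_mul (γ / 2))).congr_deriv ?_
  simp only [← Finset.mul_sum]
  ring

/-! ### The optimality system -/

variable {ε γ : ℝ} {ϑbar : Fin n → L2I} {p : Config n}

theorem IsMinimizer.exists_isLagrangeMultiplier (hmin : IsMinimizer ε γ ϑbar p)
    (hreg : IsRegularPoint p) : ∃ lam : Fin n → H1L, IsLagrangeMultiplier ε γ ϑbar p lam := by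
  have hG : HasStrictFDerivAt constraintMap (fderiv ℝ constraintMap p) p :=
    contDiff_constraintMap.contDiffAt.hasStrictFDerivAt one_ne_zero
  have hC : HasStrictFDerivAt (cost ε γ ϑbar) (fderiv ℝ (cost ε γ ϑbar) p) p :=
    (contDiff_cost ε γ ϑbar).contDiffAt.hasStrictFDerivAt one_ne_zero
  have hp := (mem_admissible_iff p).1 hmin.1
  have hext : IsLocalExtrOn (cost ε γ ϑbar) {q | constraintMap q = constraintMap p} p := by
    refine Or.inl (IsMinOn.localize fun q hq => ?_)
    exact hmin.2 q ((mem_admissible_iff q).2 (Eq.trans hq hp))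
  obtain ⟨lam, hlam⟩ := exists_lagrangeMultiplier hG hC hreg.2 hext
  refine ⟨lam, ?_⟩
  have e : fderiv ℝ (cost ε γ ϑbar) p
      = (ContinuousLinearMap.apply ℝ ℝ lam).comp (fderiv ℝ constraintMap p) :=
    ContinuousLinearMap.ext hlam
  unfold IsLagrangeMultiplier
  rw [← e]
  exact hC.hasFDerivAt

theorem H1L.coe_zero_apply (s : ℝ) : (0 : H1L) s = 0 := rfl

section Equations

variable {h : Fin n → R2} {α : H1L} {ϑ lam : Fin n → H1L}

theorem IsLagrangeMultiplier.variation (hl : IsLagrangeMultiplier ε γ ϑbar (h, α, ϑ) lam)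
    (k : Fin n → R2) (β : H1L) (η : Fin n → H1L) :
    ∑ i, inner ℝ (H1L.toL2 (ϑ i) - ϑbar i) (H1L.toL2 (η i)) + ε * inner ℝ α β
        + γ * ∑ i, inner ℝ (h i) (k i)
      = ∑ i, (inner ℝ (η i) (lam i) - ∫ s in Ioo (0 : ℝ) 1, (inner ℝ (k i) (Dm (α s + ϑ i s))
        + linCoeff (h i) α (ϑ i) s * (β s + η i s)) * lam i s) := by
  have h1 := fderiv_cost ε γ ϑbar (h, α, ϑ) (k, β, η)
  rw [HasFDerivAt.fderiv hl] at h1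
  exact h1.symm.trans (fderiv_constraintMap_apply (h, α, ϑ) (k, β, η) lam)

/-- Varying `ϑᵢ` gives the adjoint equation. -/
theorem IsLagrangeMultiplier.adjoint (hl : IsLagrangeMultiplier ε γ ϑbar (h, α, ϑ) lam)
    (i : Fin n) : IsWeakSolution 1
      (fun s => -(lam i s * linCoeff (h i) α (ϑ i) s) - (ϑ i s - ϑbar i s)) (lam i) := by
  intro w
  have h1 := hl.variation 0 0 (Pi.single i w)
  rw [Finset.sum_eq_single i, Finset.sum_eq_single (a := i) (s := Finset.univ)
    (f := fun j => inner ℝ ((Pi.single i w : Fin n → H1L) j) (lam j) - _)] at h1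
  · simp only [Pi.single_eq_same, Pi.zero_apply, inner_zero_left, inner_zero_right,
      Finset.sum_const_zero, mul_zero, add_zero, zero_add, H1L.coe_zero_apply] at h1
    have e1 : inner ℝ (H1L.toL2 (ϑ i) - ϑbar i) (H1L.toL2 w)
        = ∫ s in Ioo (0 : ℝ) 1, (ϑ i s - ϑbar i s) * w s := by
      rw [H1L.inner_toL2_right]
      apply integral_congr_ae
      filter_upwards [Lp.coeFn_sub (H1L.toL2 (ϑ i)) (ϑbar i), H1L.coeFn_toL2 (ϑ i)] with s a b
      rw [a, Pi.sub_apply, b]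
    have e2 : ∫ s in Ioo (0 : ℝ) 1,
          (-(lam i s * linCoeff (h i) α (ϑ i) s) - (ϑ i s - ϑbar i s)) * w s
        = (∫ s in Ioo (0 : ℝ) 1, -(linCoeff (h i) α (ϑ i) s * w s * lam i s))
          - ∫ s in Ioo (0 : ℝ) 1, (ϑ i s - ϑbar i s) * w s := by
      rw [← integral_sub]
      · congr 1
        ext s
        ring
      · exact (integrableOn_of_continuous (((continuous_linCoeff _ _ _).mul w.continuous).mul
          (lam i).continuous)).neg
      · exact integrableOn_mul_test ((ϑ i).integrableOn.sub (ϑbar i).integrableOn) w.continuous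
    rw [e2, integral_neg, ← e1, h1, one_mul, ← H1L.inner_eq_integral, real_inner_comm]
    ring
  · intro j _ hj
    simp only [Pi.single_eq_of_ne hj, Pi.zero_apply, inner_zero_left, H1L.coe_zero_apply]
    simp
  · simp
  · intro j _ hj
    rw [Pi.single_eq_of_ne hj, map_zero, inner_zero_right]
  · simp

/-- Varying `α` gives the design equation. -/
theorem IsLagrangeMultiplier.design (hl : IsLagrangeMultiplier ε γ ϑbar (h, α, ϑ) lam) :
    IsWeakSolution ε (fun s => ∑ i, lam i s * linCoeff (h i) α (ϑ i) s) α := by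
  intro w
  have h1 := hl.variation 0 w 0
  simp only [Pi.zero_apply, map_zero, inner_zero_left, inner_zero_right, zero_sub,
    Finset.sum_const_zero, mul_zero, add_zero, zero_add, H1L.coe_zero_apply] at h1
  rw [← H1L.inner_eq_integral, h1]
  simp only [Finset.sum_mul]
  rw [integral_finsetSum, ← Finset.sum_add_distrib]
  · refine Finset.sum_eq_zero fun i _ => ?_
    rw [neg_add_eq_zero]
    congr 1
    ext s
    ring
  · exact fun i _ => integrableOn_of_continuous
      (((lam i).continuous.mul (continuous_linCoeff _ _ _)).mul w.continuous)

/-- Varying `hᵢ` gives the equation for the magnetic field, here tested with a vector `k`. -/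
theorem IsLagrangeMultiplier.inner_field (hl : IsLagrangeMultiplier ε γ ϑbar (h, α, ϑ) lam)
    (i : Fin n) (k : R2) :
    γ * inner ℝ (h i) k = -∫ s in Ioo (0 : ℝ) 1, inner ℝ k (Dm (α s + ϑ i s)) * lam i s := by
  have h1 := hl.variation (Pi.single i k) 0 0
  rw [Finset.sum_eq_single (a := i) (s := Finset.univ) (f := fun j => inner ℝ (h j) _),
    Finset.sum_eq_single (a := i) (s := Finset.univ)
      (f := fun j => inner ℝ ((0 : Fin n → H1L) j) (lam j) - _)] at h1
  · simpa only [Pi.single_eq_same, Pi.zero_apply, inner_zero_left, inner_zero_right, map_zero,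
      Finset.sum_const_zero, mul_zero, add_zero, zero_add, zero_sub, H1L.coe_zero_apply] using h1
  · intro j _ hj
    simp only [Pi.single_eq_of_ne hj, Pi.zero_apply, inner_zero_left, H1L.coe_zero_apply]
    simp
  · simp
  · intro j _ hj
    rw [Pi.single_eq_of_ne hj, inner_zero_right]
  · simp

theorem IsLagrangeMultiplier.field (hl : IsLagrangeMultiplier ε γ ϑbar (h, α, ϑ) lam)
    (i : Fin n) :
    γ • h i = -∫ s in Ioo (0 : ℝ) 1, lam i s • Dm (α s + ϑ i s) := by
  refine ext_inner_right ℝ fun k => ?_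
  have hi : IntegrableOn (fun s => lam i s • Dm (α s + ϑ i s)) (Ioo (0 : ℝ) 1) :=
    ((lam i).continuous.smul (continuous_Dm.comp
      (α.continuous.add (ϑ i).continuous))).continuousOn.integrableOn_Icc.mono_set
      Ioo_subset_Icc_self
  rw [real_inner_smul_left, hl.inner_field i k, inner_neg_left, real_inner_comm, ← integral_inner hi]
  simp only [real_inner_smul_right, mul_comm]

/-- The moments of the optimality system vanish: `D²m` is `Dm` rotated by a right angle, and the
field equation tested with the rotated `hᵢ` gives `γ` times the scalar product of `hᵢ` with
its rotation. -/
theorem IsLagrangeMultiplier.integral_mul_linCoeff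
    (hl : IsLagrangeMultiplier ε γ ϑbar (h, α, ϑ) lam) (i : Fin n) :
    ∫ s in Ioo (0 : ℝ) 1, lam i s * linCoeff (h i) α (ϑ i) s = 0 := by
  have h1 := hl.inner_field i !₂[-(h i 1), h i 0]
  have h2 : inner ℝ (h i) !₂[-(h i 1), h i 0] = 0 := by
    simp [PiLp.inner_apply, Fin.sum_univ_two]
    ring
  rw [h2, mul_zero, ← integral_neg] at h1
  refine Eq.trans (integral_congr_ae (Filter.Eventually.of_forall fun s => ?_)) h1.symm
  unfold linCoeff
  dsimp only
  rw [inner_D2m, inner_Dm]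
  simp
  ring

theorem IsLagrangeMultiplier.solvesEQ (hl : IsLagrangeMultiplier ε γ ϑbar (h, α, ϑ) lam)
    (hadm : (h, α, ϑ) ∈ admissible n) : SolvesEQ ε γ ϑbar h α ϑ lam where
  state i := IsWeakSolution.solvesBVP
    (integrableOn_of_continuous (continuous_stateTerm _ _ _)) (hadm i)
  adjoint i := IsWeakSolution.solvesBVP
    ((integrableOn_of_continuous ((lam i).continuous.mul (continuous_linCoeff _ _ _))).neg.sub
      ((ϑ i).integrableOn.sub (ϑbar i).integrableOn)) (hl.adjoint i)
  design := IsWeakSolution.solvesBVP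
    (integrableOn_of_continuous (continuous_finsetSum _ fun i _ =>
      (lam i).continuous.mul (continuous_linCoeff _ _ _))) hl.design
  field := hl.field

/-- The clamped end is also free of moment: `ε α'(0)` is minus the integral of the
zero-order term of the design equation, which vanishes. -/
theorem IsLagrangeMultiplier.hasDerivWithinAt_zero
    (hl : IsLagrangeMultiplier ε γ ϑbar (h, α, ϑ) lam) (hε : 0 < ε) :
    HasDerivWithinAt α 0 (Icc (0 : ℝ) 1) 0 := by
  have hc (i : Fin n) : Continuous fun s => lam i s * linCoeff (h i) α (ϑ i) s :=
    (lam i).continuous.mul (continuous_linCoeff _ _ _)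
  have h1 := hl.design.hasDerivWithinAt
    (integrableOn_of_continuous (continuous_finsetSum _ fun i _ => hc i))
    (s := 0) (by simp)
  have h2 : ∫ s in (0 : ℝ)..1, ∑ i, lam i s * linCoeff (h i) α (ϑ i) s = 0 := by
    rw [intervalIntegral.integral_of_le zero_le_one, integral_Ioc_eq_integral_Ioo,
      integral_finsetSum _ fun i _ => integrableOn_of_continuous (hc i)]
    exact Finset.sum_eq_zero fun i _ => hl.integral_mul_linCoeff i
  rw [h2, intervalIntegral.integral_same, sub_zero] at h1
  have h3 := h1.const_mul ε⁻¹
  simpa only [mul_zero, inv_mul_cancel_left₀ hε.ne'] using h3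

end Equations

end

end MagElastica

theorem theorem1p2 (n : ℕ) (ε γ : ℝ) (hε : 0 ≤ ε) (hγ : 0 ≤ γ) (ϑbar : Fin n → L2I)
    (h : Fin n → R2) (α : H1L) (ϑ : Fin n → H1L) (hmin : IsMinimizer ε γ ϑbar (h, α, ϑ)) :
    ContDiff ℝ 1 (constraintMap (n := n)) ∧
    ((∀ i, ¬ IsSLEigenvalue (fun s => max (-linCoeff (h i) α (ϑ i) s) 0 + 1)
        (fun s => max (linCoeff (h i) α (ϑ i) s) 0 + 1) 1) →
      IsRegularPoint (h, α, ϑ)) ∧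
    ((∀ i, ‖h i‖ < (cP ^ 2)⁻¹) → IsRegularPoint (h, α, ϑ)) ∧
    (IsRegularPoint (h, α, ϑ) →
      (∃ lam : Fin n → H1L, IsLagrangeMultiplier ε γ ϑbar (h, α, ϑ) lam ∧
        SolvesEQ ε γ ϑbar h α ϑ lam) ∧
      (0 < ε → HasDerivWithinAt α 0 (Icc (0 : ℝ) 1) 0)) := by
  refine ⟨contDiff_constraintMap, fun hev => ?_, fun hsmall => ?_, fun hreg => ?_⟩
  · refine isRegularPoint_of_forall_eq_zero _ fun i u hu => ?_
    by_contra hne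
    exact hev i ((isSLEigenvalue_one_iff _).2 ⟨u, hne, hu⟩)
  · exact isRegularPoint_of_forall_eq_zero _ fun i u hu => eq_zero_of_norm_lt (hsmall i) hu
  · obtain ⟨lam, hlam⟩ := hmin.exists_isLagrangeMultiplier hreg
    exact ⟨⟨lam, hlam, hlam.solvesEQ hmin.1⟩, hlam.hasDerivWithinAt_zero⟩
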